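/- Let $F$ be a free group with finite ordered basis $x_1<\dots<x_m$, and let $\mathfrak f$ be the augmentation ideal of the integral group ring $\mathbb Z[F]$, i.e. the kernel of the ring homomorphism $\mathbb Z[F]\to\mathbb Z$ sending every element of $F$ to $1$. Write $\gamma_1(F)=F$ and $\gamma_{n+1}(F)=[\gamma_n(F),F]$ for the lower central series of $F$. For a two-sided ideal $\mathfrak a$ of $\mathbb Z[F]$ and $n\ge 1$ set $$D(n,\mathfrak a):=F\cap(1+\mathfrak a+\mathfrak f^n).$$ Let $e_1,\dots,e_m\ge 0$ be integers with $e_m\mid e_{m-1}\mid\dots\mid e_1$, let $S=\langle x_1^{e_1},\dots,x_m^{e_m},\gamma_2(F)\rangle$, and let $R$ be a normal subgroup of $F$ with $R\gamma_2(F)=S$. Let $\mathfrak r=\mathbb Z[F](R-1)$ be the two-sided ideal of $\mathbb Z[F]$ generated by the elements $r-1$, $r\in R$. In what follows $i,j,k$ range over $\{1,\dots,m\}$ and $e$ over $\mathbb Z$; "generated modulo $\gamma_4(F)$ by a set $X$" means equal to $\langle X\rangle\gamma_4(F)$. Then: (i) $D(4,\mathfrak f\mathfrak r\mathfrak f)$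 is the subgroup generated, modulo $\gamma_4(F)$, by the elements - $[[x_j,x_i],x_k]^{e_i}$ with $j>i$ and $k$ arbitrary; - $[[x_j,x_i],x_j]^{e}$ with $j>i$, $e_j\mid e$ and $e_i\mid 2e$. (ii) $D(4,\mathfrak r\mathfrak f\mathfrak r)$ is the subgroup generated, modulo $\gamma_4(F)$, by the elements - $[[x_j,x_i],x_k]^{e_ie_k}$ with $j>i$ and $k$ arbitrary; - $[[x_j,x_i],x_i]^{e}$ with $j>i$, $e_je_i\mid e$ and $e_i^2\mid 2e$. (iii) $D(4,\mathfrak r^2\mathfrak f+\mathfrak r\mathfrak f\mathfrak r+\mathfrak f\mathfrak r^2)=[[F,R],R]\,\gamma_4(F)$. (iv) $D(4,\mathfrak f^2\mathfrak r+\mathfrak r\mathfrak f^2)$ is the subgroup generated, modulo $\gamma_4(F)$, by the elements $[[x_j,x_i],x_k]^{e}$ with $j>i\le k$, where $e_k\mid e$ if $k\ne i$, while $e_j\mid e$ and $e_i\mid 2e$ if $k=i$. -/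

import Mathlib

open scoped commutatorElement

noncomputable section

/-- The term `γₙ(F)` (`n ≥ 1`) of the lower central series: `γ₁(F) = F`,
`γₙ₊₁(F) = [γₙ(F), F]`. -/
abbrev gammaSubgroup (F : Type*) [Group F] (n : ℕ) : Subgroup F :=
  (⊤ : Subgroup F).lowerCentralSeries (n - 1)

/-- The augmentation ideal of the integral group ring `ℤ[F]`: the kernel of the augmentation
`ℤ[F] → ℤ` that sends every element of `F` to `1`. -/
def augIdeal (F : Type*) [Group F] : Ideal (MonoidAlgebra ℤ F) :=
  RingHom.ker (MonoidAlgebra.lift ℤ ℤ F (1 : F →* ℤ))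

/-- The ideal `ℤ[F](R - 1)` of `ℤ[F]` determined by a subgroup `R` of `F`. It is two-sided when `R`
is normal (`relIdeal_isTwoSided`). -/
def relIdeal {F : Type*} [Group F] (R : Subgroup F) : Ideal (MonoidAlgebra ℤ F) :=
  Ideal.span {x | ∃ r ∈ R, x = MonoidAlgebra.of ℤ F r - 1}

instance relIdeal_isTwoSided {F : Type*} [Group F] (R : Subgroup F) [hR : R.Normal] :
    (relIdeal R).IsTwoSided := by
  constructor
  intro a c ha
  have key : ∀ g : F, ∀ x ∈ relIdeal R, x * MonoidAlgebra.of ℤ F g ∈ relIdeal R := by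
    intro g x hx
    refine Submodule.span_induction (p := fun x _ => x * MonoidAlgebra.of ℤ F g ∈ relIdeal R)
      ?_ ?_ ?_ ?_ hx
    · rintro _ ⟨r, hr, rfl⟩
      have h1 : (MonoidAlgebra.of ℤ F r - 1) * MonoidAlgebra.of ℤ F g =
          MonoidAlgebra.of ℤ F g * (MonoidAlgebra.of ℤ F (g⁻¹ * r * g) - 1) := by
        rw [sub_mul, mul_sub, ← map_mul, ← map_mul]
        simp [mul_assoc]
      rw [h1]
      refine Ideal.mul_mem_left _ _ (Ideal.subset_span ⟨_, ?_, rfl⟩)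
      simpa using hR.conj_mem r hr g⁻¹
    · simp
    · intro x y _ _ hx hy
      rw [add_mul]
      exact add_mem hx hy
    · intro s x _ hx
      rw [smul_eq_mul, mul_assoc]
      exact Ideal.mul_mem_left _ _ hx
  induction c using MonoidAlgebra.induction_on with
  | of g => exact key g a ha
  | add x y hx hy => rw [mul_add]; exact add_mem hx hy
  | smul n x hx =>
    rw [mul_smul_comm]
    exact zsmul_mem hx n

/-- The subgroup `D(n, 𝔞) = F ∩ (1 + 𝔞 + 𝔣ⁿ)` of `F`, where `𝔣` is the augmentation ideal
of `ℤ[F]`. -/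
def genDimSubgroup {F : Type*} [Group F] (n : ℕ) (𝔞 : Ideal (MonoidAlgebra ℤ F)) :
    Subgroup F where
  carrier := {w | MonoidAlgebra.of ℤ F w - 1 ∈ 𝔞 + augIdeal F ^ n}
  one_mem' := by
    simp only [Set.mem_ofPred_eq, map_one, sub_self]
    exact zero_mem _
  mul_mem' := by
    intro v w hv hw
    have h : MonoidAlgebra.of ℤ F (v * w) - 1 =
        MonoidAlgebra.of ℤ F v * (MonoidAlgebra.of ℤ F w - 1) + (MonoidAlgebra.of ℤ F v - 1) := by
      rw [map_mul]; noncomm_ring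
    simp only [Set.mem_ofPred_eq] at hv hw ⊢
    rw [h]
    exact add_mem (Ideal.mul_mem_left _ _ hw) hv
  inv_mem' := by
    intro v hv
    have h : MonoidAlgebra.of ℤ F v⁻¹ - 1 =
        (-MonoidAlgebra.of ℤ F v⁻¹) * (MonoidAlgebra.of ℤ F v - 1) := by
      rw [mul_sub, neg_mul, ← map_mul, inv_mul_cancel, map_one]; noncomm_ring
    simp only [Set.mem_ofPred_eq] at hv ⊢
    rw [h]
    exact Ideal.mul_mem_left _ _ hv

end

/-! All four ideals lie in `𝔣³`, so an element `w` of `D(4, 𝔞)` satisfies `w - 1 ∈ 𝔣³`, and Magnus'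
theorem in degree three puts `w` in `γ₃(F)`. Modulo `γ₄(F)` it is then a product of powers, with
exponents `n j i k`, of commutators `[[x_j,x_i],x_k]` in which either the smallest letter comes
second or the largest comes first. Everything reduces to arithmetic of these exponents.

Upper bound: as `w - 1` has leading form the sum of the `n j i k [[X_j,X_i],X_k]`, its coefficient
at `X_a X_b X_c` is `n a b c - n b a c - n b c a + n c b a` (`exists_commutator_exponents`). On the
other side, `Rγ₂(F) = S` makes the linear coefficient at `X_b` of every element of `𝔯` divisible by
`e_b`, so a factor `𝔯` in a triple product forces a divisor of the cubic coefficient. A well-chosen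
monomial isolates one exponent, or twice it when the commutator has a repeated letter; this is the
source of the conditions on `2e`.

Lower bound: `e_i (x_i - 1) ∈ 𝔯 + 𝔣²`, so suitable multiples of each cubic monomial lie in `𝔞 + 𝔣⁴`,
and a power of a commutator lies in `D(4, 𝔞)` once the corresponding multiple of its leading form
does (`zpow_commutator_mem_genDimSubgroup`). For (iii) the group `[[F,R],R]` is compared with powers
of commutators through multilinearity in class three.

The cubic coefficients are augmented iterated Fox derivatives; freeness enters through their
existence. Exponents `e_i = 0` need no separate treatment, since only divisibility is used. -/

/-! ### Group elements and commutators in the augmentation filtration. -/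

section GroupRing

variable {F : Type*} [Group F]

open MonoidAlgebra

/-- The augmentation `ℤ[F] → ℤ`. -/
noncomputable def augmentation (F : Type*) [Group F] : MonoidAlgebra ℤ F →ₐ[ℤ] ℤ :=
  MonoidAlgebra.lift ℤ ℤ F (1 : F →* ℤ)

@[simp] theorem augmentation_of (g : F) : augmentation F (of ℤ F g) = 1 := by
  simp [augmentation]

theorem mem_augIdeal {z : MonoidAlgebra ℤ F} : z ∈ augIdeal F ↔ augmentation F z = 0 := Iff.rfl

instance isTwoSided_sup {A : Type*} [Ring A] (I J : Ideal A) [I.IsTwoSided] [J.IsTwoSided] :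
    (I ⊔ J).IsTwoSided where
  mul_mem_of_left b h := by
    obtain ⟨y, hy, z, hz, rfl⟩ := Submodule.mem_sup.1 h
    rw [add_mul]
    exact add_mem (Ideal.mem_sup_left (I.mul_mem_right _ hy))
      (Ideal.mem_sup_right (J.mul_mem_right _ hz))

instance isTwoSided_add {A : Type*} [Ring A] (I J : Ideal A) [I.IsTwoSided] [J.IsTwoSided] :
    (I + J).IsTwoSided := isTwoSided_sup I J

instance isTwoSided_augIdeal : (augIdeal F).IsTwoSided := inferInstanceAs (RingHom.ker _).IsTwoSided

theorem of_sub_one_mem_augIdeal (g : F) : of ℤ F g - 1 ∈ augIdeal F := by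
  rw [mem_augIdeal, map_sub, augmentation_of, map_one, sub_self]

theorem mem_genDimSubgroup {n : ℕ} {I : Ideal (MonoidAlgebra ℤ F)} {g : F} :
    g ∈ genDimSubgroup n I ↔ of ℤ F g - 1 ∈ I + augIdeal F ^ n := Iff.rfl

theorem relIdeal_le_augIdeal (R : Subgroup F) : relIdeal R ≤ augIdeal F := by
  refine Ideal.span_le.2 ?_
  rintro _ ⟨r, -, rfl⟩
  exact of_sub_one_mem_augIdeal r

/-- Multiplication by a group element does not change the class of an element of `𝔣ⁿ`
modulo `𝔣ⁿ⁺¹`. -/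
theorem mul_of_sub_self_mem {n : ℕ} {z : MonoidAlgebra ℤ F} (hz : z ∈ augIdeal F ^ n) (g : F) :
    z * of ℤ F g - z ∈ augIdeal F ^ (n + 1) := by
  have : z * of ℤ F g - z = z * (of ℤ F g - 1) := by noncomm_ring
  rw [this, Submodule.pow_succ]
  exact Ideal.mul_mem_mul hz (of_sub_one_mem_augIdeal g)

theorem of_commutator_sub_one (u v : F) : of ℤ F ⁅u, v⁆ - 1 =
    ((of ℤ F u - 1) * (of ℤ F v - 1) - (of ℤ F v - 1) * (of ℤ F u - 1)) *
      of ℤ F (u⁻¹ * v⁻¹) := by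
  have h : of ℤ F ⁅u, v⁆ = of ℤ F u * of ℤ F v * of ℤ F (u⁻¹ * v⁻¹) := by
    rw [← map_mul, ← map_mul, commutatorElement_def]; congr 1; group
  have h1 : (1 : MonoidAlgebra ℤ F) = of ℤ F v * of ℤ F u * of ℤ F (u⁻¹ * v⁻¹) := by
    rw [← map_mul, ← map_mul, ← map_one (of ℤ F)]; congr 1; group
  have h2 : (of ℤ F u - 1) * (of ℤ F v - 1) - (of ℤ F v - 1) * (of ℤ F u - 1) =
    of ℤ F u * of ℤ F v - of ℤ F v * of ℤ F u := by noncomm_ring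
  rw [h2, sub_mul, ← h, ← h1]

theorem of_commutator_sub_one_mem_mul_sup (I J : Ideal (MonoidAlgebra ℤ F)) [I.IsTwoSided]
    [J.IsTwoSided] {u v : F} (hu : of ℤ F u - 1 ∈ I) (hv : of ℤ F v - 1 ∈ J) :
    of ℤ F ⁅u, v⁆ - 1 ∈ I * J + J * I := by
  rw [of_commutator_sub_one]
  refine Ideal.mul_mem_right _ _ (sub_mem ?_ ?_)
  · exact Ideal.mem_sup_left (Ideal.mul_mem_mul hu hv)
  · exact Ideal.mem_sup_right (Ideal.mul_mem_mul hv hu)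

/-- Passing to leading forms turns group commutators into ring commutators: the trailing unit
`u⁻¹v⁻¹` is congruent to `1` modulo `𝔣`, and replacing a factor by its leading form costs one extra
degree. -/
theorem of_commutator_sub_one_sub_mem {p q : ℕ} {u v : F} {U V : MonoidAlgebra ℤ F}
    (hU : U ∈ augIdeal F ^ p) (hV : V ∈ augIdeal F ^ q)
    (hu : of ℤ F u - 1 - U ∈ augIdeal F ^ (p + 1)) (hv : of ℤ F v - 1 - V ∈ augIdeal F ^ (q + 1)) :
    of ℤ F ⁅u, v⁆ - 1 - (U * V - V * U) ∈ augIdeal F ^ (p + q + 1) := by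
  have hmul : ∀ {a b n : ℕ} {y z : MonoidAlgebra ℤ F}, a + b = n → y ∈ augIdeal F ^ a →
      z ∈ augIdeal F ^ b → y * z ∈ augIdeal F ^ n := by
    intro a b n y z h hy hz
    rw [← h, Ideal.IsTwoSided.pow_add]
    exact Ideal.mul_mem_mul hy hz
  have hu' : of ℤ F u - 1 ∈ augIdeal F ^ p := by
    have := add_mem (Ideal.pow_le_pow_right (Nat.le_succ p) hu) hU
    simpa using this
  have hv' : of ℤ F v - 1 ∈ augIdeal F ^ q := by
    have := add_mem (Ideal.pow_le_pow_right (Nat.le_succ q) hv) hV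
    simpa using this
  rw [of_commutator_sub_one]
  set A := of ℤ F u - 1
  set B := of ℤ F v - 1
  have h1 : A * B - B * A ∈ augIdeal F ^ (p + q) :=
    sub_mem (hmul rfl hu' hv') (hmul (add_comm q p) hv' hu')
  have h2 : (A * B - B * A) * of ℤ F (u⁻¹ * v⁻¹) - (U * V - V * U) =
      ((A * B - B * A) * of ℤ F (u⁻¹ * v⁻¹) - (A * B - B * A)) +
      ((A - U) * B + U * (B - V) - ((B - V) * A + V * (A - U))) := by noncomm_ring
  rw [h2]
  refine add_mem (mul_of_sub_self_mem h1 _) (sub_mem (add_mem ?_ ?_) (add_mem ?_ ?_))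
  · exact hmul (by ring) hu hv'
  · exact hmul (by ring) hU hv
  · exact hmul (by ring) hv hu'
  · exact hmul (by ring) hV hu

theorem of_sub_one_mem_of_mem_lowerCentralSeries {n : ℕ} {w : F}
    (hw : w ∈ (⊤ : Subgroup F).lowerCentralSeries n) : of ℤ F w - 1 ∈ augIdeal F ^ (n + 1) := by
  -- With the zero ideal, the condition `g - 1 ∈ 𝔣ⁿ` defines a subgroup, so commutators need only be
  -- checked on generators.
  have hmem : ∀ {n : ℕ} {g : F}, g ∈ genDimSubgroup n ⊥ ↔ of ℤ F g - 1 ∈ augIdeal F ^ n := by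
    intro n g
    rw [mem_genDimSubgroup, Submodule.add_eq_sup, bot_sup_eq]
  suffices h : ∀ n, (⊤ : Subgroup F).lowerCentralSeries n ≤ genDimSubgroup (n + 1) ⊥ by
    exact hmem.1 (h n hw)
  intro n
  induction n with
  | zero =>
    intro g _
    exact hmem.2 (by rw [zero_add, Submodule.pow_one]; exact of_sub_one_mem_augIdeal g)
  | succ n ih =>
    rw [Subgroup.lowerCentralSeries_succ, Subgroup.commutator_le]
    intro u hu v _
    have hu' : of ℤ F u - 1 ∈ augIdeal F ^ (n + 1) := hmem.1 (ih hu)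
    have := of_commutator_sub_one_mem_mul_sup _ _ hu' (of_sub_one_mem_augIdeal v)
    have : of ℤ F ⁅u, v⁆ - 1 ∈ augIdeal F ^ (n + 1 + 1) := by
      rwa [← Submodule.pow_succ, ← Ideal.IsTwoSided.pow_succ, Submodule.add_eq_sup, sup_idem] at this
    exact hmem.2 this

theorem of_mul_sub_one (u v : F) : of ℤ F (u * v) - 1 =
    (of ℤ F u - 1) + (of ℤ F v - 1) + (of ℤ F u - 1) * (of ℤ F v - 1) := by
  rw [map_mul]; noncomm_ring

/-- Modulo `I`, the map `g ↦ gⁿ - 1` is `n (g - 1)` as soon as `(g - 1)² ∈ I`. -/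
theorem of_zpow_sub_one_sub_mem (I : Ideal (MonoidAlgebra ℤ F)) [I.IsTwoSided] {g : F}
    (hg : (of ℤ F g - 1) * (of ℤ F g - 1) ∈ I) (n : ℤ) :
    of ℤ F (g ^ n) - 1 - n • (of ℤ F g - 1) ∈ I := by
  set A := of ℤ F g - 1
  have hm : ∀ u, of ℤ F (u * g) - 1 = (of ℤ F u - 1) + A + (of ℤ F u - 1) * A :=
    fun u => of_mul_sub_one u g
  have key : ∀ (z : MonoidAlgebra ℤ F) (k : ℤ), z - k • A ∈ I → z * A ∈ I := by
    intro z k hz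
    have h : z * A = (z - k • A) * A + k • (A * A) := by
      rw [sub_mul, smul_mul_assoc]; abel
    rw [h]
    exact add_mem (Ideal.mul_mem_right _ _ hz) (zsmul_mem hg k)
  induction n with
  | zero => rw [zpow_zero, map_one, zero_smul, sub_zero, sub_self]; exact zero_mem _
  | succ n ih =>
    rw [zpow_add_one, hm]
    have := add_mem ih (key _ _ ih)
    convert this using 1
    rw [add_smul, one_smul]; abel
  | pred n ih =>
    have hs : of ℤ F (g ^ (-(n : ℤ))) - 1 = of ℤ F (g ^ (-(n : ℤ) - 1) * g) - 1 := by
      rw [← zpow_add_one]; simp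
    rw [hs, hm] at ih
    set B := of ℤ F (g ^ (-(n : ℤ) - 1)) - 1
    have e1 : B - (-(n : ℤ) - 1) • A = (B + A + B * A - (-(n : ℤ)) • A) - B * A := by
      rw [sub_smul, one_smul]; abel
    -- Multiplying the induction hypothesis by `A` leaves `B * A` up to multiples of `A * A`, hence
    -- `B * A ∈ I`; this is the term to be removed in `e1`.
    have e2 : (B + A + B * A - (-(n : ℤ)) • A) * A =
        B * A + (B * (A * A) + (A * A) + (n : ℤ) • (A * A)) := by
      simp only [sub_mul, add_mul, smul_mul_assoc, mul_assoc, neg_smul, neg_mul]; abel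
    have h2 := Ideal.mul_mem_right A _ ih
    rw [e2] at h2
    have h3 : B * (A * A) + (A * A) + (n : ℤ) • (A * A) ∈ I :=
      add_mem (add_mem (Ideal.mul_mem_left _ _ hg) hg) (zsmul_mem hg _)
    rw [e1]
    exact sub_mem ih ((Submodule.add_mem_iff_left _ h3).1 h2)

end GroupRing

/-! ### Fox derivatives and Magnus coefficients of degree at most three. -/

section FoxCalculus

variable {F : Type*} [Group F] {ι : Type*} [DecidableEq ι] (x : FreeGroupBasis ι F)

open MonoidAlgebra

theorem FreeGroupBasis.closure_range_eq_top {ι F : Type*} [Group F] (x : FreeGroupBasis ι F) :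
    Subgroup.closure (Set.range x) = ⊤ := by
  rw [eq_top_iff]
  intro g _
  set f : F →* Subgroup.closure (Set.range x) :=
    x.lift (fun i => ⟨x i, Subgroup.subset_closure ⟨i, rfl⟩⟩)
  have hf : (Subgroup.subtype _).comp f = MonoidHom.id F :=
    x.ext_hom _ _ fun i => by simp [f]
  have := DFunLike.congr_fun hf g
  rw [MonoidHom.id_apply] at this
  rw [← this]
  exact (f g).2

/-- The affine action of `F` on `ℤ[F]` in which a basis element `x i` acts by
`y ↦ x i * y + δ i a`. -/
noncomputable def foxAction (a : ι) : F →* Equiv.Perm (MonoidAlgebra ℤ F) :=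
  x.lift fun i =>
    { toFun := fun y => of ℤ F (x i) * y + if i = a then 1 else 0
      invFun := fun y => of ℤ F (x i)⁻¹ * (y - if i = a then 1 else 0)
      left_inv := fun y => by
        beta_reduce
        rw [add_sub_cancel_right, ← mul_assoc, ← map_mul, inv_mul_cancel, map_one, one_mul]
      right_inv := fun y => by
        beta_reduce
        rw [← mul_assoc, ← map_mul, mul_inv_cancel, map_one, one_mul, sub_add_cancel] }

theorem foxAction_basis (a i : ι) (y : MonoidAlgebra ℤ F) :
    foxAction x a (x i) y = of ℤ F (x i) * y + if i = a then 1 else 0 := by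
  rw [foxAction, FreeGroupBasis.lift_apply_apply, x.repr_apply_coe, FreeGroup.lift_apply_of]
  rfl

/-- Each group element acts affinely with linear part left multiplication. Evaluating at `0`
therefore gives a cocycle, which is the Fox product rule. -/
theorem foxAction_apply (a : ι) (g : F) (y : MonoidAlgebra ℤ F) :
    foxAction x a g y = of ℤ F g * y + foxAction x a g 0 := by
  have hg : g ∈ Subgroup.closure (Set.range x) := by
    rw [x.closure_range_eq_top]; exact Subgroup.mem_top g
  induction hg using Subgroup.closure_induction generalizing y with
  | mem g hg =>
    obtain ⟨i, rfl⟩ := hg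
    rw [foxAction_basis, foxAction_basis, mul_zero, zero_add]
  | one => rw [map_one, map_one, Equiv.Perm.one_apply, Equiv.Perm.one_apply, one_mul, add_zero]
  | mul g h _ _ ihg ihh =>
    rw [map_mul, Equiv.Perm.mul_apply, Equiv.Perm.mul_apply, ihg, ihh, ihg (foxAction x a h 0),
      map_mul]
    noncomm_ring
  | inv g _ ih =>
    rw [map_inv, Equiv.Perm.inv_eq_iff_eq, ih, mul_add, ← mul_assoc, ← map_mul, mul_inv_cancel,
      map_one, one_mul, add_assoc, ← ih, ← Equiv.Perm.mul_apply, mul_inv_cancel,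
      Equiv.Perm.one_apply, add_zero]

/-- The left Fox derivative `∂/∂xₐ : ℤ[F] → ℤ[F]`. -/
noncomputable def foxDeriv (a : ι) : MonoidAlgebra ℤ F →+ MonoidAlgebra ℤ F :=
  liftNC (Int.castAddHom _) fun g => foxAction x a g 0

theorem foxDeriv_of (a : ι) (g : F) : foxDeriv x a (of ℤ F g) = foxAction x a g 0 := by
  rw [foxDeriv, of_apply, liftNC_single]
  simp

theorem foxDeriv_basis (a i : ι) : foxDeriv x a (of ℤ F (x i)) = if i = a then 1 else 0 := by
  rw [foxDeriv_of, foxAction_basis, mul_zero, zero_add]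

theorem foxDeriv_one (a : ι) : foxDeriv x a 1 = 0 := by
  rw [← map_one (of ℤ F), foxDeriv_of, map_one, Equiv.Perm.one_apply]

theorem foxDeriv_mul (a : ι) (u v : MonoidAlgebra ℤ F) :
    foxDeriv x a (u * v) = u * foxDeriv x a v + augmentation F v • foxDeriv x a u := by
  induction u using MonoidAlgebra.induction_on with
  | add u₁ u₂ h₁ h₂ => rw [add_mul, map_add, map_add, h₁, h₂, add_mul, smul_add]; abel
  | smul n u h =>
    rw [smul_mul_assoc, map_zsmul, map_zsmul, h, smul_add, smul_mul_assoc, smul_comm n]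
  | of g =>
    induction v using MonoidAlgebra.induction_on with
    | add v₁ v₂ h₁ h₂ => rw [mul_add, map_add, map_add, map_add, h₁, h₂, mul_add, add_smul]; abel
    | smul n v h =>
      rw [mul_smul_comm, map_zsmul, map_zsmul, map_zsmul, h, smul_add, mul_smul_comm,
        smul_eq_mul, mul_smul]
    | of h =>
      rw [← map_mul, foxDeriv_of, foxDeriv_of, foxDeriv_of, map_mul, Equiv.Perm.mul_apply,
        foxAction_apply, augmentation_of, one_smul]

theorem foxDeriv_mul_of_mem {a : ι} (u : MonoidAlgebra ℤ F) {v : MonoidAlgebra ℤ F}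
    (hv : v ∈ augIdeal F) : foxDeriv x a (u * v) = u * foxDeriv x a v := by
  rw [foxDeriv_mul, mem_augIdeal.1 hv, zero_smul, add_zero]

/-- On a product whose last factor is in `𝔣`, the derivative acts on that factor alone, so it lowers
the filtration by one. Iterating, the coefficients of degree `n` vanish on `𝔣ⁿ⁺¹`. -/
theorem foxDeriv_mem_pow {a : ι} {n : ℕ} {z : MonoidAlgebra ℤ F} (hz : z ∈ augIdeal F ^ (n + 1)) :
    foxDeriv x a z ∈ augIdeal F ^ n := by
  rw [Submodule.pow_succ] at hz
  refine Submodule.mul_induction_on hz ?_ ?_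
  · intro u hu v hv
    rw [foxDeriv_mul_of_mem x u hv]
    exact Ideal.mul_mem_right _ _ hu
  · intro u v hu hv
    rw [map_add]
    exact add_mem hu hv

/-- The coefficient of `Xₐ` in the Magnus expansion. -/
noncomputable def magnusCoeff₁ (a : ι) : MonoidAlgebra ℤ F →+ ℤ :=
  (augmentation F : MonoidAlgebra ℤ F →+ ℤ).comp (foxDeriv x a)

/-- The coefficient of `Xₐ X_b` in the Magnus expansion. -/
noncomputable def magnusCoeff₂ (a b : ι) : MonoidAlgebra ℤ F →+ ℤ :=
  (magnusCoeff₁ x a).comp (foxDeriv x b)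

/-- The coefficient of `Xₐ X_b X_c` in the Magnus expansion. -/
noncomputable def magnusCoeff₃ (a b c : ι) : MonoidAlgebra ℤ F →+ ℤ :=
  (magnusCoeff₂ x a b).comp (foxDeriv x c)

theorem magnusCoeff₁_apply (a : ι) (z : MonoidAlgebra ℤ F) :
    magnusCoeff₁ x a z = augmentation F (foxDeriv x a z) := rfl

theorem magnusCoeff₂_apply (a b : ι) (z : MonoidAlgebra ℤ F) :
    magnusCoeff₂ x a b z = magnusCoeff₁ x a (foxDeriv x b z) := rfl

theorem magnusCoeff₃_apply (a b c : ι) (z : MonoidAlgebra ℤ F) :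
    magnusCoeff₃ x a b c z = magnusCoeff₂ x a b (foxDeriv x c z) := rfl

theorem magnusCoeff₁_eq_zero (a : ι) {z : MonoidAlgebra ℤ F} (hz : z ∈ augIdeal F ^ 2) :
    magnusCoeff₁ x a z = 0 := by
  have := foxDeriv_mem_pow x (a := a) hz
  rw [Submodule.pow_one] at this
  exact mem_augIdeal.1 this

theorem magnusCoeff₂_eq_zero (a b : ι) {z : MonoidAlgebra ℤ F} (hz : z ∈ augIdeal F ^ 3) :
    magnusCoeff₂ x a b z = 0 := by
  rw [magnusCoeff₂_apply]
  exact magnusCoeff₁_eq_zero x a (foxDeriv_mem_pow x (n := 2) hz)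

theorem magnusCoeff₃_eq_zero (a b c : ι) {z : MonoidAlgebra ℤ F} (hz : z ∈ augIdeal F ^ 4) :
    magnusCoeff₃ x a b c z = 0 := by
  rw [magnusCoeff₃_apply]
  exact magnusCoeff₂_eq_zero x a b (foxDeriv_mem_pow x (n := 3) hz)

theorem magnusCoeff₁_basis (a i : ι) :
    magnusCoeff₁ x a (of ℤ F (x i) - 1) = if i = a then 1 else 0 := by
  rw [magnusCoeff₁_apply, map_sub, foxDeriv_one, sub_zero, foxDeriv_basis]
  split_ifs <;> simp

theorem magnusCoeff₁_mul_of_mem_left (a : ι) {u : MonoidAlgebra ℤ F} (hu : u ∈ augIdeal F)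
    (y : MonoidAlgebra ℤ F) : magnusCoeff₁ x a (u * y) = magnusCoeff₁ x a u * augmentation F y := by
  rw [magnusCoeff₁_apply, foxDeriv_mul, map_add, map_mul, mem_augIdeal.1 hu, zero_mul, zero_add,
    map_smul, smul_eq_mul, mul_comm, magnusCoeff₁_apply]

theorem magnusCoeff₁_mul_of_mem_right (a : ι) (y : MonoidAlgebra ℤ F) {u : MonoidAlgebra ℤ F}
    (hu : u ∈ augIdeal F) : magnusCoeff₁ x a (y * u) = augmentation F y * magnusCoeff₁ x a u := by
  rw [magnusCoeff₁_apply, foxDeriv_mul_of_mem x y hu, map_mul, magnusCoeff₁_apply]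

theorem magnusCoeff₂_mul (a b : ι) {u v : MonoidAlgebra ℤ F} (hu : u ∈ augIdeal F)
    (hv : v ∈ augIdeal F) :
    magnusCoeff₂ x a b (u * v) = magnusCoeff₁ x a u * magnusCoeff₁ x b v := by
  rw [magnusCoeff₂_apply, foxDeriv_mul_of_mem x u hv, magnusCoeff₁_mul_of_mem_left x a hu,
    magnusCoeff₁_apply x b]

theorem magnusCoeff₃_mul (a b c : ι) {u v w : MonoidAlgebra ℤ F} (hu : u ∈ augIdeal F)
    (hv : v ∈ augIdeal F) (hw : w ∈ augIdeal F) : magnusCoeff₃ x a b c (u * v * w) =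
      magnusCoeff₁ x a u * magnusCoeff₁ x b v * magnusCoeff₁ x c w := by
  rw [magnusCoeff₃_apply, foxDeriv_mul_of_mem x _ hw, mul_assoc, magnusCoeff₂_mul x a b hu
    (Ideal.mul_mem_right _ _ hv), magnusCoeff₁_mul_of_mem_left x b hv, ← magnusCoeff₁_apply,
    mul_assoc]

/-- A divisor of the products of the linear coefficients of the factors divides the corresponding
coefficient of every element of a triple product of ideals. -/
theorem dvd_magnusCoeff₃_of_mem_mul {a b c : ι} {d : ℤ} {I J K : Ideal (MonoidAlgebra ℤ F)}
    (hI : I ≤ augIdeal F) (hJ : J ≤ augIdeal F) (hK : K ≤ augIdeal F)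
    (h : ∀ u ∈ I, ∀ v ∈ J, ∀ w ∈ K,
      d ∣ magnusCoeff₁ x a u * magnusCoeff₁ x b v * magnusCoeff₁ x c w)
    {z : MonoidAlgebra ℤ F} (hz : z ∈ I * J * K) : d ∣ magnusCoeff₃ x a b c z := by
  refine Submodule.mul_induction_on hz (fun y hy w hw => ?_) fun y z hy hz => ?_
  · refine Submodule.mul_induction_on hy (fun u hu v hv => ?_) fun y z hy hz => ?_
    · rw [magnusCoeff₃_mul x a b c (hI hu) (hJ hv) (hK hw)]
      exact h u hu v hv w hw
    · rw [add_mul, map_add]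
      exact dvd_add hy hz
  · rw [map_add]
    exact dvd_add hy hz

theorem dvd_magnusCoeff₃_of_mem_add {a b c : ι} {d : ℤ} {I : Ideal (MonoidAlgebra ℤ F)}
    (h : ∀ z ∈ I, d ∣ magnusCoeff₃ x a b c z) {z : MonoidAlgebra ℤ F}
    (hz : z ∈ I + augIdeal F ^ 4) : d ∣ magnusCoeff₃ x a b c z := by
  obtain ⟨y, hy, w, hw, rfl⟩ := Submodule.mem_sup.1 hz
  rw [map_add, magnusCoeff₃_eq_zero x a b c hw, add_zero]
  exact h y hy

theorem magnusCoeff₁_of_mul_sub_one (a : ι) (g h : F) : magnusCoeff₁ x a (of ℤ F (g * h) - 1) =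
    magnusCoeff₁ x a (of ℤ F g - 1) + magnusCoeff₁ x a (of ℤ F h - 1) := by
  rw [of_mul_sub_one, map_add, map_add, magnusCoeff₁_mul_of_mem_right x a _
    (of_sub_one_mem_augIdeal h), mem_augIdeal.1 (of_sub_one_mem_augIdeal g), zero_mul, add_zero]

/-- The exponent sum of `xₐ`. -/
noncomputable def exponentSum (a : ι) : F →* Multiplicative ℤ where
  toFun g := Multiplicative.ofAdd (magnusCoeff₁ x a (of ℤ F g - 1))
  map_one' := by rw [map_one, sub_self, map_zero, ofAdd_zero]
  map_mul' g h := by rw [magnusCoeff₁_of_mul_sub_one, ofAdd_add]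

theorem toAdd_exponentSum (a : ι) (g : F) :
    (exponentSum x a g).toAdd = magnusCoeff₁ x a (of ℤ F g - 1) := rfl

/-- Left multiplication by `y` only scales the linear coefficient of an element of `𝔣` by the
augmentation of `y`, so the generators `r - 1` decide. -/
theorem dvd_magnusCoeff₁_of_mem_relIdeal {a : ι} {d : ℤ} {R : Subgroup F}
    (hR : ∀ r ∈ R, d ∣ magnusCoeff₁ x a (of ℤ F r - 1)) {z : MonoidAlgebra ℤ F}
    (hz : z ∈ relIdeal R) : d ∣ magnusCoeff₁ x a z := by
  refine Submodule.span_induction (p := fun z _ => d ∣ magnusCoeff₁ x a z) ?_ ?_ ?_ ?_ hz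
  · rintro _ ⟨r, hr, rfl⟩
    exact hR r hr
  · rw [map_zero]; exact dvd_zero d
  · intro y z _ _ hy hz
    rw [map_add]
    exact dvd_add hy hz
  · intro y z hz h
    rw [smul_eq_mul, magnusCoeff₁_mul_of_mem_right x a y (relIdeal_le_augIdeal R hz)]
    exact dvd_mul_of_dvd_right h _

end FoxCalculus

/-! ### Commutator calculus modulo a central layer and in nilpotency class three. -/

section Commutators

variable {F : Type*} [Group F]

theorem conj_mem_of_commutator_mem {N K : Subgroup F} (hN : N ≤ K) {g z : F} (hg : g ∈ K)
    (h : ⁅g, z⁆ ∈ N) : z * g * z⁻¹ ∈ K := by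
  have : z * g * z⁻¹ = ⁅g, z⁆⁻¹ * g := by
    rw [commutatorElement_inv, commutatorElement_def]; group
  rw [this]
  exact mul_mem (inv_mem (hN h)) hg

/-- If commutators of elements of `⟨S⟩` and `⟨X⟩` are central modulo `N`, then modulo `N` the group
`[⟨S⟩, ⟨X⟩]` is generated by the commutators of elements of `S` and `X`. -/
theorem commutator_closure_closure_le {S X : Set F} {N K : Subgroup F} (hN : N ≤ K)
    (hc : ∀ a ∈ Subgroup.closure S, ∀ y ∈ Subgroup.closure X, ∀ z : F, ⁅⁅a, y⁆, z⁆ ∈ N)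
    (h : ∀ s ∈ S, ∀ y ∈ X, ⁅s, y⁆ ∈ K) :
    ⁅Subgroup.closure S, Subgroup.closure X⁆ ≤ K := by
  have h1 : ∀ s ∈ S, ∀ y ∈ Subgroup.closure X, ⁅s, y⁆ ∈ K := by
    intro s hs y hy
    have hs' := Subgroup.subset_closure hs
    induction hy using Subgroup.closure_induction with
    | mem y hy => exact h s hs y hy
    | one => rw [commutatorElement_one_right]; exact one_mem K
    | mul y z hy hz ihy ihz =>
      rw [commutatorElement_mul_right_eq_mul_conj, mul_assoc, mul_assoc, ← mul_assoc y]
      exact mul_mem ihy (conj_mem_of_commutator_mem hN ihz (hc s hs' z hz y))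
    | inv y hy ihy =>
      rw [commutatorElement_inv_right, ← commutatorElement_inv]
      have := conj_mem_of_commutator_mem hN ihy (hc s hs' y hy y⁻¹)
      simpa [mul_assoc] using inv_mem this
  rw [Subgroup.commutator_le]
  intro a ha y hy
  induction ha using Subgroup.closure_induction with
  | mem s hs => exact h1 s hs y hy
  | one => rw [commutatorElement_one_left]; exact one_mem K
  | mul a b ha hb iha ihb =>
    rw [commutatorElement_mul_left_eq_conj_mul]
    exact mul_mem (conj_mem_of_commutator_mem hN ihb (hc b hb y hy a)) iha
  | inv a ha iha =>
    rw [commutatorElement_inv_left, ← commutatorElement_inv]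
    have := conj_mem_of_commutator_mem hN iha (hc a ha y hy a⁻¹)
    simpa [mul_assoc] using inv_mem this

open scoped IsMulCommutative in
/-- A representation of the elements of `H` modulo `N` as products of powers of generators of `H`
that are central modulo `N`, together with the values of additive functions on `H / N`. -/
theorem exists_zpow_representation {H N : Subgroup F} [N.Normal] {ι κ : Type*} [Fintype ι]
    (g : ι → F) (hgH : ∀ i, g i ∈ H) (hNH : N ≤ H) (hg : ∀ i y, ⁅g i, y⁆ ∈ N)
    (hH : H ≤ Subgroup.closure (Set.range g) ⊔ N) (c : κ → F → ℤ)
    (hadd : ∀ k, ∀ u ∈ H, ∀ v ∈ H, c k (u * v) = c k u + c k v) (hc : ∀ k, ∀ u ∈ N, c k u = 0)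
    {w : F} (hw : w ∈ H) :
    ∃ n : ι → ℤ, (∀ k, c k w = ∑ i, n i * c k (g i)) ∧
      ∀ T : Subgroup F, N ≤ T → (∀ i, g i ^ n i ∈ T) → w ∈ T := by
  classical
  -- Working in the centre of `F ⧸ N` makes the product of powers independent of order.
  let z : ι → Subgroup.center (F ⧸ N) := fun i => ⟨(g i : F ⧸ N), by
    rw [Subgroup.mem_center_iff]
    intro y
    obtain ⟨y, rfl⟩ := QuotientGroup.mk_surjective y
    refine (commutatorElement_eq_one_iff_mul_comm.1 ?_).symm
    exact (QuotientGroup.eq_one_iff _).2 (hg i y)⟩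
  have hle : Subgroup.closure (Set.range g) ≤ H :=
    (Subgroup.closure_le H).2 (by rintro _ ⟨i, rfl⟩; exact hgH i)
  have hone : ∀ k, c k 1 = 0 := fun k => hc k 1 (one_mem N)
  have key : ∀ u ∈ Subgroup.closure (Set.range g), ∃ n : ι → ℤ,
      (∀ k, c k u = ∑ i, n i * c k (g i)) ∧
        (u : F ⧸ N) = ((∏ i, z i ^ n i : Subgroup.center (F ⧸ N)) : F ⧸ N) := by
    intro u hu
    induction hu using Subgroup.closure_induction with
    | mem u hu =>
      obtain ⟨i, rfl⟩ := hu
      refine ⟨Pi.single i 1, fun k => ?_, ?_⟩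
      · simp [Pi.single_apply]
      · rw [Finset.prod_eq_single i]
        · simp [z]
        · intro j _ hj; simp [Pi.single_eq_of_ne hj]
        · simp
    | one => exact ⟨0, fun k => by simp [hone], by simp⟩
    | mul u v hu hv ihu ihv =>
      obtain ⟨n, hn, hn'⟩ := ihu
      obtain ⟨l, hl, hl'⟩ := ihv
      refine ⟨n + l, fun k => ?_, ?_⟩
      · rw [hadd k u (hle hu) v (hle hv), hn, hl, ← Finset.sum_add_distrib]
        simp [add_mul]
      · rw [QuotientGroup.mk_mul, hn', hl', ← Subgroup.coe_mul, ← Finset.prod_mul_distrib]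
        simp [zpow_add]
    | inv u hu ihu =>
      obtain ⟨n, hn, hn'⟩ := ihu
      refine ⟨-n, fun k => ?_, ?_⟩
      · have := hadd k u (hle hu) u⁻¹ (inv_mem (hle hu))
        rw [mul_inv_cancel, hone, hn] at this
        simp only [Pi.neg_apply, neg_mul, Finset.sum_neg_distrib]
        omega
      · rw [QuotientGroup.mk_inv, hn', ← Subgroup.coe_inv, ← Finset.prod_inv_distrib]
        simp [zpow_neg]
  obtain ⟨u, hu, v, hv, rfl⟩ := Subgroup.mem_sup_of_normal_right.1 (hH hw)
  obtain ⟨n, hn, hn'⟩ := key u hu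
  refine ⟨n, fun k => ?_, fun T hT hgT => ?_⟩
  · rw [hadd k u (hle hu) v (hNH hv), hc k v hv, add_zero, hn]
  · refine mul_mem ?_ (hT hv)
    have h1 : ∀ i, z i ^ n i ∈ (T.map (QuotientGroup.mk' N)).comap (Subgroup.center _).subtype :=
      fun i => ⟨g i ^ n i, hgT i, rfl⟩
    have h2 : (u : F ⧸ N) ∈ T.map (QuotientGroup.mk' N) := by
      rw [hn']
      exact prod_mem (S := (T.map (QuotientGroup.mk' N)).comap (Subgroup.center _).subtype)
        fun i _ => h1 i
    obtain ⟨t, ht, htu⟩ := h2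
    have h3 : t⁻¹ * u ∈ N := QuotientGroup.eq.1 htu
    have := mul_mem ht (hT h3)
    rwa [mul_inv_cancel_left] at this

theorem commutator_mul_right_of_central {u : F} (hu : ∀ c d : F, ⁅⁅u, c⁆, d⁆ = 1) (c c' : F) :
    ⁅u, c * c'⁆ = ⁅u, c⁆ * ⁅u, c'⁆ := by
  rw [commutatorElement_mul_right_eq_mul_conj, mul_assoc, mul_assoc, ← mul_assoc c,
    ← commutatorElement_eq_one_iff_mul_comm.1 (hu c' c), mul_inv_cancel_right]

theorem commutator_mul_left_of_central {u v c : F} (hv : ∀ d : F, ⁅⁅v, c⁆, d⁆ = 1) :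
    ⁅u * v, c⁆ = ⁅v, c⁆ * ⁅u, c⁆ := by
  rw [commutatorElement_mul_left_eq_conj_mul,
    ← commutatorElement_eq_one_iff_mul_comm.1 (hv u), mul_inv_cancel_right]

/-- The homomorphism `c ↦ ⁅u, c⁆`, for `u` central modulo the centre. -/
def commutatorRightHom (u : F) (hu : ∀ c d : F, ⁅⁅u, c⁆, d⁆ = 1) : F →* F where
  toFun c := ⁅u, c⁆
  map_one' := commutatorElement_one_right u
  map_mul' := commutator_mul_right_of_central hu

/-- The homomorphism `b ↦ ⁅⁅a, b⁆, c⁆` in a group of nilpotency class at most three. -/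
def commutatorMiddleHom (h : ∀ a b c d : F, ⁅⁅⁅a, b⁆, c⁆, d⁆ = 1) (a c : F) : F →* F where
  toFun b := ⁅⁅a, b⁆, c⁆
  map_one' := by rw [commutatorElement_one_right, commutatorElement_one_left]
  map_mul' b b' := by
    have h1 : ⁅a, b * b'⁆ = ⁅a, b⁆ * (⁅b, ⁅a, b'⁆⁆ * ⁅a, b'⁆) := by
      simp [commutatorElement_def, mul_assoc]
    -- The left side is a conjugate of a commutator, hence itself a commutator, so its commutator
    -- with `c` is central.
    have h2 : ⁅b, ⁅a, b'⁆⁆ * ⁅a, b'⁆ = ⁅b * a * b⁻¹, b * b' * b⁻¹⁆ := by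
      simp [commutatorElement_def, mul_assoc]
    have h3 : ⁅⁅b, ⁅a, b'⁆⁆, c⁆ = 1 := by
      rw [commutatorElement_eq_one_iff_commute, ← commutatorElement_inv]
      exact (commutatorElement_eq_one_iff_commute.1 (h a b' b c)).inv_left
    rw [h1, commutator_mul_left_of_central (by rw [h2]; exact h _ _ c),
      commutator_mul_left_of_central (h _ _ c), h3, mul_one]
    exact commutatorElement_eq_one_iff_mul_comm.1 (h _ _ _ _)

theorem map_eq_one_of_mem_commutator {G : Type*} [Group G] (f : F →* G)
    (hf : ∀ a b : F, ⁅f a, f b⁆ = 1) {u : F} (hu : u ∈ ⁅(⊤ : Subgroup F), (⊤ : Subgroup F)⁆) : f u = 1 := by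
  have : ⁅(⊤ : Subgroup F), (⊤ : Subgroup F)⁆ ≤ f.ker := Subgroup.commutator_le.2 fun a _ b _ => by
    rw [MonoidHom.mem_ker, map_commutatorElement, hf]
  exact this hu

/-- The triple commutator is a homomorphism in its second and third entries and kills commutators
there, so `r` and `s` may be replaced by `b ^ n` and `c ^ k`. -/
theorem commutator_eq_zpow_mul (h : ∀ a b c d : F, ⁅⁅⁅a, b⁆, c⁆, d⁆ = 1) {a b c r s u v : F}
    {n k : ℤ} (hu : u ∈ ⁅(⊤ : Subgroup F), (⊤ : Subgroup F)⁆)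
    (hv : v ∈ ⁅(⊤ : Subgroup F), (⊤ : Subgroup F)⁆)
    (hb : b ^ n = r * u) (hc : c ^ k = s * v) : ⁅⁅a, r⁆, s⁆ = ⁅⁅a, b⁆, c⁆ ^ (n * k) := by
  have h1 : ∀ y : F, ⁅⁅a, r⁆, y⁆ = ⁅⁅a, b⁆, y⁆ ^ n := by
    intro y
    let f := commutatorMiddleHom h a y
    change f r = f b ^ n
    rw [← map_zpow, hb, map_mul, map_eq_one_of_mem_commutator f (fun _ _ => h _ _ _ _) hu, mul_one]
  let f := commutatorRightHom ⁅a, b⁆ (h a b)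
  have h2 : ⁅⁅a, b⁆, s⁆ = ⁅⁅a, b⁆, c⁆ ^ k := by
    change f s = f c ^ k
    rw [← map_zpow, hc, map_mul, map_eq_one_of_mem_commutator f (fun _ _ => h _ _ _ _) hv, mul_one]
  rw [h1, h2, ← zpow_mul, mul_comm]

/-- The Jacobi identity in a group of nilpotency class at most three. -/
theorem commutator_jacobi_of_class_three (h : ∀ a b c d : F, ⁅⁅⁅a, b⁆, c⁆, d⁆ = 1) (a b c : F) :
    ⁅⁅a, b⁆, c⁆ * ⁅⁅b, c⁆, a⁆ * ⁅⁅c, a⁆, b⁆ = 1 := by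
  -- The Hall–Witt identity carries a conjugate in the last entry; in class three this conjugation
  -- has no effect.
  have key : ∀ a b c : F, ⁅⁅a, b⁆, b * c * b⁻¹⁆ = ⁅⁅a, b⁆, c⁆ := by
    intro a b c
    let f := commutatorRightHom ⁅a, b⁆ (h a b)
    change f (b * c * b⁻¹) = f c
    have : f b * f c = f c * f b := commutatorElement_eq_one_iff_mul_comm.1 (h a b b (f c))
    rw [map_mul, map_mul, map_inv, this, mul_inv_cancel_right]
  have := commutatorElement_commutatorElement_conj_mul a b c
  rwa [key, key, key] at this

theorem commutator_quotient_eq_one (a b c d : F ⧸ (⊤ : Subgroup F).lowerCentralSeries 3) :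
    ⁅⁅⁅a, b⁆, c⁆, d⁆ = 1 := by
  obtain ⟨a, rfl⟩ := QuotientGroup.mk_surjective a
  obtain ⟨b, rfl⟩ := QuotientGroup.mk_surjective b
  obtain ⟨c, rfl⟩ := QuotientGroup.mk_surjective c
  obtain ⟨d, rfl⟩ := QuotientGroup.mk_surjective d
  refine (QuotientGroup.eq_one_iff ⁅⁅⁅a, b⁆, c⁆, d⁆).2 ?_
  have ht : ∀ y : F, y ∈ (⊤ : Subgroup F) := Subgroup.mem_top
  exact Subgroup.commutator_mem_commutator (Subgroup.commutator_mem_commutator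
    (Subgroup.commutator_mem_commutator (ht a) (ht b)) (ht c)) (ht d)

theorem commutator_mem_lowerCentralSeries {n : ℕ} {u : F}
    (hu : u ∈ (⊤ : Subgroup F).lowerCentralSeries n) (v : F) :
    ⁅u, v⁆ ∈ (⊤ : Subgroup F).lowerCentralSeries (n + 1) :=
  Subgroup.commutator_mem_commutator hu (Subgroup.mem_top v)

theorem commutator_mem_lowerCentralSeries_one (a b : F) :
    ⁅a, b⁆ ∈ (⊤ : Subgroup F).lowerCentralSeries 1 :=
  commutator_mem_lowerCentralSeries (n := 0) (Subgroup.mem_top a) b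

theorem commutator_mem_lowerCentralSeries_two (a b c : F) :
    ⁅⁅a, b⁆, c⁆ ∈ (⊤ : Subgroup F).lowerCentralSeries 2 :=
  commutator_mem_lowerCentralSeries (commutator_mem_lowerCentralSeries_one a b) c

theorem commutator_mem_of_rotate {K : Subgroup F}
    (hK : (⊤ : Subgroup F).lowerCentralSeries 3 ≤ K) {a b c : F} (h1 : ⁅⁅b, c⁆, a⁆ ∈ K)
    (h2 : ⁅⁅c, a⁆, b⁆ ∈ K) : ⁅⁅a, b⁆, c⁆ ∈ K := by
  have h : ⁅⁅a, b⁆, c⁆ * ⁅⁅b, c⁆, a⁆ * ⁅⁅c, a⁆, b⁆ ∈ K := by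
    refine hK ((QuotientGroup.eq_one_iff (⁅⁅a, b⁆, c⁆ * ⁅⁅b, c⁆, a⁆ * ⁅⁅c, a⁆, b⁆)).1 ?_)
    exact commutator_jacobi_of_class_three commutator_quotient_eq_one (a : F ⧸ _) b c
  rwa [Subgroup.mul_mem_cancel_right _ h2, Subgroup.mul_mem_cancel_right _ h1] at h

theorem zpow_commutator_mem_of_swap {K : Subgroup F}
    (hK : (⊤ : Subgroup F).lowerCentralSeries 3 ≤ K) {a b c : F} {n : ℤ}
    (h : ⁅⁅b, a⁆, c⁆ ^ n ∈ K) : ⁅⁅a, b⁆, c⁆ ^ n ∈ K := by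
  have h1 := conj_mem_of_commutator_mem hK (z := ⁅b, a⁆⁻¹) h
    (commutator_mem_lowerCentralSeries
      (zpow_mem (commutator_mem_lowerCentralSeries_two b a c) n) _)
  have h2 : ⁅⁅a, b⁆, c⁆ = (⁅b, a⁆⁻¹ * ⁅⁅b, a⁆, c⁆ * ⁅b, a⁆⁻¹⁻¹)⁻¹ := by
    rw [← commutatorElement_inv b a, commutatorElement_inv_left, ← commutatorElement_inv _ c]
    simp only [mul_inv_rev, inv_inv, mul_assoc]
  rw [h2, inv_zpow, conj_zpow]
  exact inv_mem h1

theorem commutator_mem_of_swap {K : Subgroup F}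
    (hK : (⊤ : Subgroup F).lowerCentralSeries 3 ≤ K) {a b c : F} (h : ⁅⁅b, a⁆, c⁆ ∈ K) :
    ⁅⁅a, b⁆, c⁆ ∈ K := by
  simpa only [zpow_one] using zpow_commutator_mem_of_swap hK (n := 1) (by rwa [zpow_one])

theorem zpow_commutator_mem {T : Subgroup F} (hT : (⊤ : Subgroup F).lowerCentralSeries 3 ≤ T)
    {a b c r s u v : F} {n k : ℤ} (hu : u ∈ (⊤ : Subgroup F).lowerCentralSeries 1)
    (hv : v ∈ (⊤ : Subgroup F).lowerCentralSeries 1) (hb : b ^ n = r * u) (hc : c ^ k = s * v)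
    (h : ⁅⁅a, r⁆, s⁆ ∈ T) : ⁅⁅a, b⁆, c⁆ ^ (n * k) ∈ T := by
  let q := QuotientGroup.mk' ((⊤ : Subgroup F).lowerCentralSeries 3)
  let A : Subgroup (F ⧸ (⊤ : Subgroup F).lowerCentralSeries 3) := ⊤
  have hq : ∀ {y : F}, y ∈ (⊤ : Subgroup F).lowerCentralSeries 1 → q y ∈ ⁅A, A⁆ := by
    intro y hy
    refine Subgroup.commutator_mono le_top le_top (?_ : q y ∈ ⁅Subgroup.map q ⊤, Subgroup.map q ⊤⁆)
    rw [← Subgroup.map_commutator]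
    exact Subgroup.mem_map_of_mem q hy
  have h1 := commutator_eq_zpow_mul commutator_quotient_eq_one (a := q a) (b := q b) (c := q c)
    (r := q r) (s := q s) (n := n) (k := k) (hq hu) (hq hv)
    (by rw [← map_zpow, hb, map_mul]) (by rw [← map_zpow, hc, map_mul])
  have h2 : q ⁅⁅a, r⁆, s⁆ = q (⁅⁅a, b⁆, c⁆ ^ (n * k)) := by
    rw [map_zpow]; simpa only [map_commutatorElement] using h1
  have := mul_mem h (hT (QuotientGroup.eq.1 h2))
  rwa [mul_inv_cancel_left] at this

end Commutators

/-! ### Generators of `γ₂/γ₃` and `γ₃/γ₄`, and their detection by Magnus coefficients. -/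

section FreeGroup

open MonoidAlgebra

variable {F : Type*} [Group F] {ι : Type*} [LinearOrder ι] (x : FreeGroupBasis ι F)

theorem lowerCentralSeries_one_le_of_basis {K : Subgroup F}
    (hK : (⊤ : Subgroup F).lowerCentralSeries 2 ≤ K) (h : ∀ i j, i < j → ⁅x j, x i⁆ ∈ K) :
    (⊤ : Subgroup F).lowerCentralSeries 1 ≤ K := by
  have h1 : ⁅Subgroup.closure (Set.range x), Subgroup.closure (Set.range x)⁆ ≤ K := by
    refine commutator_closure_closure_le hK
      (fun a _ y _ z => commutator_mem_lowerCentralSeries_two a y z) ?_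
    rintro _ ⟨j, rfl⟩ _ ⟨i, rfl⟩
    rcases lt_trichotomy i j with hij | rfl | hij
    · exact h i j hij
    · rw [commutatorElement_self]; exact one_mem K
    · rw [← commutatorElement_inv]; exact inv_mem (h j i hij)
  rw [x.closure_range_eq_top] at h1
  exact h1

theorem lowerCentralSeries_two_le_of_basis {K : Subgroup F}
    (hK : (⊤ : Subgroup F).lowerCentralSeries 3 ≤ K)
    (h : ∀ i j k, i < j → ⁅⁅x j, x i⁆, x k⁆ ∈ K) :
    (⊤ : Subgroup F).lowerCentralSeries 2 ≤ K := by
  let S : Set F := {w | ∃ i j, i < j ∧ w = ⁅x j, x i⁆} ∪ (⊤ : Subgroup F).lowerCentralSeries 2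
  have hS : Subgroup.closure S = (⊤ : Subgroup F).lowerCentralSeries 1 := by
    apply le_antisymm
    · rw [Subgroup.closure_le]
      rintro _ (⟨i, j, -, rfl⟩ | hw)
      · exact commutator_mem_lowerCentralSeries_one _ _
      · exact Subgroup.lowerCentralSeries_antitone _ one_le_two hw
    · exact lowerCentralSeries_one_le_of_basis x
        (fun w hw => Subgroup.subset_closure (Or.inr hw))
        (fun i j hij => Subgroup.subset_closure (Or.inl ⟨i, j, hij, rfl⟩))
  have h1 : ⁅Subgroup.closure S, Subgroup.closure (Set.range x)⁆ ≤ K := by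
    refine commutator_closure_closure_le hK (fun a ha y _ z => ?_) ?_
    · rw [hS] at ha
      exact commutator_mem_lowerCentralSeries (commutator_mem_lowerCentralSeries ha y) z
    · rintro _ (⟨i, j, hij, rfl⟩ | hw) _ ⟨k, rfl⟩
      · exact h i j k hij
      · exact hK (commutator_mem_lowerCentralSeries hw _)
  rw [hS, x.closure_range_eq_top] at h1
  exact h1

/-- If `k < i`, Jacobi expresses `[[x_j,x_i],x_k]` through two commutators with the smallest letter
`x_k` inside the inner bracket, where antisymmetry moves it to second place. -/
theorem lowerCentralSeries_two_le_of_min {K : Subgroup F}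
    (hK : (⊤ : Subgroup F).lowerCentralSeries 3 ≤ K)
    (h : ∀ i j k, i < j → i ≤ k → ⁅⁅x j, x i⁆, x k⁆ ∈ K) :
    (⊤ : Subgroup F).lowerCentralSeries 2 ≤ K := by
  refine lowerCentralSeries_two_le_of_basis x hK fun i j k hij => ?_
  rcases le_or_gt i k with hik | hik
  · exact h i j k hij hik
  · exact commutator_mem_of_rotate hK (h k i j hik (hik.trans hij).le)
      (commutator_mem_of_swap hK (h k j i (hik.trans hij) hik.le))

/-- The same Jacobi rotation, now bringing the largest letter to first place. -/
theorem lowerCentralSeries_two_le_of_max {K : Subgroup F}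
    (hK : (⊤ : Subgroup F).lowerCentralSeries 3 ≤ K)
    (h : ∀ i j k, i < j → k ≤ j → ⁅⁅x j, x i⁆, x k⁆ ∈ K) :
    (⊤ : Subgroup F).lowerCentralSeries 2 ≤ K := by
  refine lowerCentralSeries_two_le_of_basis x hK fun i j k hij => ?_
  rcases le_or_gt k j with hkj | hkj
  · exact h i j k hij hkj
  · exact commutator_mem_of_rotate hK
      (commutator_mem_of_swap hK (h i k j (hij.trans hkj) hkj.le))
      (h j k i hkj (hij.trans hkj).le)

/-- The cross term `(u - 1)(v - 1)` lies in `𝔣²ⁿ⁺²`, which is contained in `𝔣ⁿ⁺²`. -/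
theorem add_of_mul_sub_one {n : ℕ} (f : MonoidAlgebra ℤ F →+ ℤ)
    (hf : ∀ z ∈ augIdeal F ^ (n + 1 + 1), f z = 0) {u v : F}
    (hu : u ∈ (⊤ : Subgroup F).lowerCentralSeries n)
    (hv : v ∈ (⊤ : Subgroup F).lowerCentralSeries n) :
    f (of ℤ F (u * v) - 1) = f (of ℤ F u - 1) + f (of ℤ F v - 1) := by
  have hu' := of_sub_one_mem_of_mem_lowerCentralSeries hu
  have hv' := of_sub_one_mem_of_mem_lowerCentralSeries hv
  have huv := Ideal.mul_mem_mul hu' hv'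
  rw [← Ideal.IsTwoSided.pow_add] at huv
  rw [of_mul_sub_one, map_add, map_add,
    hf _ (Ideal.pow_le_pow_right (show n + 1 + 1 ≤ n + 1 + (n + 1) by omega) huv), add_zero]

theorem of_basis_commutator_sub_mem {ι F : Type*} [Group F]
    (x : FreeGroupBasis ι F) (i j : ι) :
    of ℤ F ⁅x j, x i⁆ - 1 - ((of ℤ F (x j) - 1) * (of ℤ F (x i) - 1) -
      (of ℤ F (x i) - 1) * (of ℤ F (x j) - 1)) ∈ augIdeal F ^ 3 := by
  have h1 : ∀ i, of ℤ F (x i) - 1 ∈ augIdeal F ^ 1 := fun i => by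
    rw [Submodule.pow_one]; exact of_sub_one_mem_augIdeal _
  refine of_commutator_sub_one_sub_mem (p := 1) (q := 1) (h1 j) (h1 i) ?_ ?_
  all_goals rw [sub_self]; exact zero_mem _

theorem of_basis_commutator_commutator_sub_mem {ι F : Type*} [Group F]
    (x : FreeGroupBasis ι F) (i j k : ι) :
    of ℤ F ⁅⁅x j, x i⁆, x k⁆ - 1 -
      ((of ℤ F (x j) - 1) * (of ℤ F (x i) - 1) * (of ℤ F (x k) - 1) -
        (of ℤ F (x i) - 1) * (of ℤ F (x j) - 1) * (of ℤ F (x k) - 1) -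
        (of ℤ F (x k) - 1) * (of ℤ F (x j) - 1) * (of ℤ F (x i) - 1) +
        (of ℤ F (x k) - 1) * (of ℤ F (x i) - 1) * (of ℤ F (x j) - 1)) ∈ augIdeal F ^ 4 := by
  have h1 : ∀ i, of ℤ F (x i) - 1 ∈ augIdeal F ^ 1 := fun i => by
    rw [Submodule.pow_one]; exact of_sub_one_mem_augIdeal _
  have h2 : ∀ i j, (of ℤ F (x i) - 1) * (of ℤ F (x j) - 1) ∈ augIdeal F ^ 2 := fun i j => by
    rw [Submodule.pow_succ]; exact Ideal.mul_mem_mul (h1 i) (of_sub_one_mem_augIdeal _)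
  have := of_commutator_sub_one_sub_mem (p := 2) (q := 1) (v := x k) (sub_mem (h2 j i) (h2 i j))
    (h1 k) (of_basis_commutator_sub_mem x i j) (by rw [sub_self]; exact zero_mem _)
  convert this using 1
  noncomm_ring

theorem magnusCoeff₂_basis_commutator (a b i j : ι) :
    magnusCoeff₂ x a b (of ℤ F ⁅x j, x i⁆ - 1) =
      (if j = a then 1 else 0) * (if i = b then 1 else 0) -
        (if i = a then 1 else 0) * (if j = b then 1 else 0) := by
  have h := magnusCoeff₂_eq_zero x a b (of_basis_commutator_sub_mem x i j)
  have h1 := fun i => of_sub_one_mem_augIdeal (x i)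
  rw [map_sub, sub_eq_zero] at h
  rw [h, map_sub, magnusCoeff₂_mul x _ _ (h1 _) (h1 _), magnusCoeff₂_mul x _ _ (h1 _) (h1 _)]
  simp only [magnusCoeff₁_basis]

theorem magnusCoeff₃_basis_commutator (a b c i j k : ι) :
    magnusCoeff₃ x a b c (of ℤ F ⁅⁅x j, x i⁆, x k⁆ - 1) =
      (if j = a then 1 else 0) * (if i = b then 1 else 0) * (if k = c then 1 else 0) -
      (if i = a then 1 else 0) * (if j = b then 1 else 0) * (if k = c then 1 else 0) -
      (if k = a then 1 else 0) * (if j = b then 1 else 0) * (if i = c then 1 else 0) +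
      (if k = a then 1 else 0) * (if i = b then 1 else 0) * (if j = c then 1 else 0) := by
  have h := magnusCoeff₃_eq_zero x a b c (of_basis_commutator_commutator_sub_mem x i j k)
  have h1 := fun i => of_sub_one_mem_augIdeal (x i)
  rw [map_sub, sub_eq_zero] at h
  rw [h, map_add, map_sub, map_sub, magnusCoeff₃_mul x _ _ _ (h1 _) (h1 _) (h1 _),
    magnusCoeff₃_mul x _ _ _ (h1 _) (h1 _) (h1 _), magnusCoeff₃_mul x _ _ _ (h1 _) (h1 _) (h1 _),
    magnusCoeff₃_mul x _ _ _ (h1 _) (h1 _) (h1 _)]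
  simp only [magnusCoeff₁_basis]

variable [Fintype ι]

theorem mem_lowerCentralSeries_one_of_magnusCoeff₁ {w : F}
    (hw : ∀ a, magnusCoeff₁ x a (of ℤ F w - 1) = 0) :
    w ∈ (⊤ : Subgroup F).lowerCentralSeries 1 := by
  obtain ⟨n, hn, hT⟩ := exists_zpow_representation (H := ⊤)
    (N := (⊤ : Subgroup F).lowerCentralSeries 1) x (fun _ => Subgroup.mem_top _) le_top
    (fun i y => commutator_mem_lowerCentralSeries_one _ _)
    (by rw [x.closure_range_eq_top]; exact le_sup_left)
    (fun a w => magnusCoeff₁ x a (of ℤ F w - 1))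
    (fun a u _ v _ => magnusCoeff₁_of_mul_sub_one x a u v)
    (fun a u hu => magnusCoeff₁_eq_zero x a (of_sub_one_mem_of_mem_lowerCentralSeries hu))
    (Subgroup.mem_top w)
  refine hT _ le_rfl fun i => ?_
  have h := hn i
  simp only [hw, magnusCoeff₁_basis] at h
  simp at h
  rw [← h, zpow_zero]
  exact one_mem _

theorem mem_lowerCentralSeries_two_of_magnusCoeff₂ {w : F}
    (hw1 : w ∈ (⊤ : Subgroup F).lowerCentralSeries 1)
    (hw : ∀ a b, magnusCoeff₂ x a b (of ℤ F w - 1) = 0) :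
    w ∈ (⊤ : Subgroup F).lowerCentralSeries 2 := by
  -- Padding with `1` off the pairs `i < j` lets the exponents be indexed by all pairs. The
  -- coefficient at `X_j X_i` then picks out the exponent of `[x_j,x_i]`, the reversed pair
  -- contributing nothing.
  let g : ι × ι → F := fun t => if t.2 < t.1 then ⁅x t.1, x t.2⁆ else 1
  have hg : ∀ t, g t ∈ (⊤ : Subgroup F).lowerCentralSeries 1 := by
    intro t
    by_cases h : t.2 < t.1
    · simp only [g, if_pos h]; exact commutator_mem_lowerCentralSeries_one _ _
    · simp only [g, if_neg h]; exact one_mem _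
  obtain ⟨n, hn, hT⟩ := exists_zpow_representation (κ := ι × ι)
    (N := (⊤ : Subgroup F).lowerCentralSeries 2) g hg
    (Subgroup.lowerCentralSeries_antitone _ one_le_two)
    (fun t y => commutator_mem_lowerCentralSeries (hg t) y)
    (lowerCentralSeries_one_le_of_basis x le_sup_right fun i j hij =>
      Subgroup.mem_sup_left (Subgroup.subset_closure ⟨(j, i), if_pos hij⟩))
    (fun a w => magnusCoeff₂ x a.1 a.2 (of ℤ F w - 1))
    (fun a u hu v hv => add_of_mul_sub_one _ (fun z hz => magnusCoeff₂_eq_zero x a.1 a.2 hz) hu hv)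
    (fun a u hu => magnusCoeff₂_eq_zero x a.1 a.2 (of_sub_one_mem_of_mem_lowerCentralSeries hu))
    hw1
  have hc : ∀ (a t : ι × ι), n t * magnusCoeff₂ x a.1 a.2 (of ℤ F (g t) - 1) =
      (if t.2 < t.1 then n t else 0) * ((if t.1 = a.1 then 1 else 0) * (if t.2 = a.2 then 1 else 0) -
        (if t.2 = a.1 then 1 else 0) * (if t.1 = a.2 then 1 else 0)) := by
    intro a t
    by_cases h : t.2 < t.1
    · simp only [g, if_pos h, magnusCoeff₂_basis_commutator]
    · simp only [g, if_neg h, map_one, sub_self, map_zero, mul_zero, zero_mul]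
  refine hT _ le_rfl fun t => ?_
  by_cases h : t.2 < t.1
  · have := hn t
    simp only [hw, hc] at this
    simp [Fintype.sum_prod_type, mul_sub, Finset.sum_sub_distrib, h, h.not_gt] at this
    rw [← this, zpow_zero]
    exact one_mem _
  · simp only [g, if_neg h, one_zpow]; exact one_mem _

/-- Magnus' theorem in degree three: the linear coefficients vanish, giving `γ₂(F)`, and then the
quadratic ones, giving `γ₃(F)`. -/
theorem mem_lowerCentralSeries_two_of_sub_one_mem (x : FreeGroupBasis ι F) {w : F}
    (hw : of ℤ F w - 1 ∈ augIdeal F ^ 3) :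
    w ∈ (⊤ : Subgroup F).lowerCentralSeries 2 :=
  mem_lowerCentralSeries_two_of_magnusCoeff₂ x
    (mem_lowerCentralSeries_one_of_magnusCoeff₁ x fun a =>
      magnusCoeff₁_eq_zero x a (Ideal.pow_le_pow_right (by norm_num) hw))
    fun a b => magnusCoeff₂_eq_zero x a b hw

/-- Elements of `γ₃(F)` modulo `γ₄(F)` as products of powers of a spanning family of commutators
of weight three in the basis, together with their Magnus coefficients. -/
theorem exists_commutator_exponents (p : ι → ι → ι → Prop)
    (hp : (⊤ : Subgroup F).lowerCentralSeries 2 ≤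
      Subgroup.closure {w | ∃ j i k, p j i k ∧ w = ⁅⁅x j, x i⁆, x k⁆} ⊔
        (⊤ : Subgroup F).lowerCentralSeries 3)
    {w : F} (hw : w ∈ (⊤ : Subgroup F).lowerCentralSeries 2) :
    ∃ n : ι → ι → ι → ℤ, (∀ j i k, ¬ p j i k → n j i k = 0) ∧
      (∀ a b c, magnusCoeff₃ x a b c (of ℤ F w - 1) = n a b c - n b a c - n b c a + n c b a) ∧
      ∀ T : Subgroup F, (⊤ : Subgroup F).lowerCentralSeries 3 ≤ T →
        (∀ j i k, p j i k → ⁅⁅x j, x i⁆, x k⁆ ^ n j i k ∈ T) → w ∈ T := by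
  classical
  let g : ι × ι × ι → F := fun t =>
    if p t.1 t.2.1 t.2.2 then ⁅⁅x t.1, x t.2.1⁆, x t.2.2⁆ else 1
  have hg : ∀ t, g t ∈ (⊤ : Subgroup F).lowerCentralSeries 2 := by
    intro t
    by_cases h : p t.1 t.2.1 t.2.2
    · simp only [g, if_pos h]; exact commutator_mem_lowerCentralSeries_two _ _ _
    · simp only [g, if_neg h]; exact one_mem _
  obtain ⟨n, hn, hT⟩ := exists_zpow_representation (κ := ι × ι × ι)
    (N := (⊤ : Subgroup F).lowerCentralSeries 3) g hg
    (Subgroup.lowerCentralSeries_antitone _ (by norm_num))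
    (fun t y => commutator_mem_lowerCentralSeries (hg t) y)
    (hp.trans (sup_le_sup_right (Subgroup.closure_mono (by
      rintro _ ⟨j, i, k, h, rfl⟩
      exact ⟨(j, i, k), if_pos h⟩)) _))
    (fun a w => magnusCoeff₃ x a.1 a.2.1 a.2.2 (of ℤ F w - 1))
    (fun a u hu v hv => add_of_mul_sub_one _
      (fun z hz => magnusCoeff₃_eq_zero x a.1 a.2.1 a.2.2 hz) hu hv)
    (fun a u hu => magnusCoeff₃_eq_zero x a.1 a.2.1 a.2.2
      (of_sub_one_mem_of_mem_lowerCentralSeries hu))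
    hw
  refine ⟨fun j i k => if p j i k then n (j, i, k) else 0, fun j i k h => if_neg h,
    fun a b c => ?_, fun T h3 h => hT T h3 fun t => ?_⟩
  · have hc : ∀ t, n t * magnusCoeff₃ x a b c (of ℤ F (g t) - 1) =
        (if p t.1 t.2.1 t.2.2 then n (t.1, t.2.1, t.2.2) else 0) *
        ((if t.1 = a then 1 else 0) * (if t.2.1 = b then 1 else 0) * (if t.2.2 = c then 1 else 0) -
        (if t.2.1 = a then 1 else 0) * (if t.1 = b then 1 else 0) * (if t.2.2 = c then 1 else 0) -
        (if t.2.2 = a then 1 else 0) * (if t.1 = b then 1 else 0) * (if t.2.1 = c then 1 else 0) +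
        (if t.2.2 = a then 1 else 0) * (if t.2.1 = b then 1 else 0) *
          (if t.1 = c then 1 else 0)) := by
      intro t
      by_cases h : p t.1 t.2.1 t.2.2
      · simp only [g, if_pos h, magnusCoeff₃_basis_commutator]
      · simp only [g, if_neg h, map_one, sub_self, map_zero, mul_zero, zero_mul]
    rw [hn (a, b, c)]
    simp only [hc]
    generalize hN : (fun j i k => if p j i k then n (j, i, k) else 0) = N
    have hN' : ∀ j i k, (if p j i k then n (j, i, k) else 0) = N j i k := fun j i k => by rw [← hN]
    simp only [hN']
    simp [Fintype.sum_prod_type, mul_sub, mul_add, Finset.sum_sub_distrib, Finset.sum_add_distrib]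
  · by_cases hpt : p t.1 t.2.1 t.2.2
    · have := h _ _ _ hpt
      simpa only [g, if_pos hpt] using this
    · simp only [g, if_neg hpt, one_zpow]; exact one_mem _

end FreeGroup

/-! ### Reduction of both inclusions to leading forms and exponents. -/

section DimensionSubgroups

open MonoidAlgebra

variable {F : Type*} [Group F]

theorem mul_le_augIdeal_pow_three {I J K : Ideal (MonoidAlgebra ℤ F)} (hI : I ≤ augIdeal F)
    (hJ : J ≤ augIdeal F) (hK : K ≤ augIdeal F) : I * J * K ≤ augIdeal F ^ 3 := by
  have h : augIdeal F ^ 3 = augIdeal F * augIdeal F * augIdeal F := by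
    rw [Submodule.pow_succ, Submodule.pow_succ, Submodule.pow_one]
  rw [h]
  exact Ideal.mul_mono (Ideal.mul_mono hI hJ) hK

/-- Each factor has degree at least one, so an error in `𝔣²` in any factor pushes the triple product
into `𝔣⁴`. -/
theorem mul_mem_mul_add_augIdeal_pow {I J K : Ideal (MonoidAlgebra ℤ F)} (hI : I ≤ augIdeal F)
    (hJ : J ≤ augIdeal F) (hK : K ≤ augIdeal F) {u v w : MonoidAlgebra ℤ F}
    (hu : u ∈ I + augIdeal F ^ 2) (hv : v ∈ J + augIdeal F ^ 2) (hw : w ∈ K + augIdeal F ^ 2) :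
    u * v * w ∈ I * J * K + augIdeal F ^ 4 := by
  have hle : ∀ {L : Ideal (MonoidAlgebra ℤ F)}, L ≤ augIdeal F → ∀ {y}, y ∈ L + augIdeal F ^ 2 →
      y ∈ augIdeal F ^ 1 := by
    intro L hL y hy
    rw [Submodule.pow_one]
    refine (sup_le hL ?_ : L + augIdeal F ^ 2 ≤ augIdeal F) hy
    have := Ideal.pow_le_pow_right (I := augIdeal F) one_le_two
    rwa [Submodule.pow_one] at this
  have hv' := hle hJ hv
  have hw' := hle hK hw
  have hmul : ∀ {a b n : ℕ} {y z : MonoidAlgebra ℤ F}, a + b = n → y ∈ augIdeal F ^ a →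
      z ∈ augIdeal F ^ b → y * z ∈ augIdeal F ^ n := by
    intro a b n y z h hy hz
    rw [← h, Ideal.IsTwoSided.pow_add]
    exact Ideal.mul_mem_mul hy hz
  obtain ⟨u₁, hu₁, u₂, hu₂, rfl⟩ := Submodule.mem_sup.1 hu
  obtain ⟨v₁, hv₁, v₂, hv₂, rfl⟩ := Submodule.mem_sup.1 hv
  obtain ⟨w₁, hw₁, w₂, hw₂, rfl⟩ := Submodule.mem_sup.1 hw
  have hI' : u₁ ∈ augIdeal F ^ 1 := by rw [Submodule.pow_one]; exact hI hu₁
  have hJ' : v₁ ∈ augIdeal F ^ 1 := by rw [Submodule.pow_one]; exact hJ hv₁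
  have h : (u₁ + u₂) * (v₁ + v₂) * (w₁ + w₂) = u₁ * v₁ * w₁ +
      (u₁ * v₁ * w₂ + u₁ * v₂ * (w₁ + w₂) + u₂ * (v₁ + v₂) * (w₁ + w₂)) := by noncomm_ring
  rw [h]
  refine add_mem (Ideal.mem_sup_left (Ideal.mul_mem_mul (Ideal.mul_mem_mul hu₁ hv₁) hw₁))
    (Ideal.mem_sup_right (add_mem (add_mem ?_ ?_) ?_))
  · exact hmul (by norm_num) (hmul (n := 2) rfl hI' hJ') hw₂
  · exact hmul (by norm_num) (hmul (n := 3) rfl hI' hv₂) hw'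
  · exact hmul (by norm_num) (hmul (n := 3) rfl hu₂ hv') hw'

theorem lowerCentralSeries_three_le_genDimSubgroup (I : Ideal (MonoidAlgebra ℤ F)) :
    (⊤ : Subgroup F).lowerCentralSeries 3 ≤ genDimSubgroup 4 I := fun _ hw =>
  mem_genDimSubgroup.2 (Ideal.mem_sup_right (of_sub_one_mem_of_mem_lowerCentralSeries hw))

/-- Elements of `[F,R]` are `1` modulo `𝔣𝔯 + 𝔯𝔣 + 𝔣⁴`; bracketing with `𝔯` on either side yields
exactly the three products. -/
theorem commutator_le_genDimSubgroup (R : Subgroup F) [R.Normal] :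
    ⁅⁅(⊤ : Subgroup F), R⁆, R⁆ ≤ genDimSubgroup 4 (relIdeal R ^ 2 * augIdeal F +
      relIdeal R * augIdeal F * relIdeal R + augIdeal F * relIdeal R ^ 2) := by
  have hr : ∀ r ∈ R, of ℤ F r - 1 ∈ relIdeal R := fun r h => Ideal.subset_span ⟨r, h, rfl⟩
  have h1 : ⁅(⊤ : Subgroup F), R⁆ ≤
      genDimSubgroup 4 (augIdeal F * relIdeal R + relIdeal R * augIdeal F) :=
    Subgroup.commutator_le.2 fun a _ b hb => mem_genDimSubgroup.2 (Ideal.mem_sup_left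
      (of_commutator_sub_one_mem_mul_sup _ _ (of_sub_one_mem_augIdeal a) (hr b hb)))
  have hsq : relIdeal R ^ 2 = relIdeal R * relIdeal R := by
    rw [Submodule.pow_succ, Submodule.pow_one]
  rw [Subgroup.commutator_le, hsq]
  intro a ha b hb
  obtain ⟨y, hy, z, hz, hyz⟩ := Submodule.mem_sup.1 (mem_genDimSubgroup.1 (h1 ha))
  obtain ⟨u, hu, v, hv, rfl⟩ := Submodule.mem_sup.1 hy
  have hB := hr b hb
  rw [mem_genDimSubgroup, of_commutator_sub_one, ← hyz]
  refine Ideal.mul_mem_right _ _ ?_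
  set B := of ℤ F b - 1
  have h2 : (u + v + z) * B - B * (u + v + z) =
      (-(B * v) + (v * B - B * u) + u * B) + (z * B - B * z) := by noncomm_ring
  rw [h2]
  refine add_mem (Ideal.mem_sup_left (add_mem (Ideal.mem_sup_left (add_mem
    (Ideal.mem_sup_left (neg_mem ?_)) (Ideal.mem_sup_right (sub_mem ?_ ?_))))
    (Ideal.mem_sup_right ?_))) (Ideal.mem_sup_right
      (sub_mem (Ideal.mul_mem_right _ _ hz) (Ideal.mul_mem_left _ _ hz)))
  · rw [mul_assoc]
    exact Ideal.mul_mem_mul hB hv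
  · exact Ideal.mul_mem_mul hv hB
  · rw [mul_assoc]
    exact Ideal.mul_mem_mul hB hu
  · rw [← mul_assoc]
    exact Ideal.mul_mem_mul hu hB

variable {ι : Type*} (x : FreeGroupBasis ι F)

theorem zpow_commutator_mem_genDimSubgroup {I : Ideal (MonoidAlgebra ℤ F)} [I.IsTwoSided]
    {i j k : ι} {n : ℤ}
    (h : n • ((of ℤ F (x j) - 1) * (of ℤ F (x i) - 1) * (of ℤ F (x k) - 1)) -
        n • ((of ℤ F (x i) - 1) * (of ℤ F (x j) - 1) * (of ℤ F (x k) - 1)) -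
        n • ((of ℤ F (x k) - 1) * (of ℤ F (x j) - 1) * (of ℤ F (x i) - 1)) +
        n • ((of ℤ F (x k) - 1) * (of ℤ F (x i) - 1) * (of ℤ F (x j) - 1)) ∈ I + augIdeal F ^ 4) :
    ⁅⁅x j, x i⁆, x k⁆ ^ n ∈ genDimSubgroup 4 I := by
  have h3 := of_sub_one_mem_of_mem_lowerCentralSeries
    (commutator_mem_lowerCentralSeries_two (x j) (x i) (x k))
  have h6 := Ideal.mul_mem_mul h3 h3
  rw [← Ideal.IsTwoSided.pow_add] at h6
  -- For `g ∈ γ₃(F)` the square of `g - 1` is in `𝔣⁶`, so `gⁿ - 1` is `n (g - 1)` modulo `𝔣⁴`.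
  have h4 := of_zpow_sub_one_sub_mem _
    (Ideal.pow_le_pow_right (show 4 ≤ 2 + 1 + (2 + 1) by norm_num) h6) n
  have h5 := zsmul_mem (of_basis_commutator_commutator_sub_mem x i j k) n
  have h7 := add_mem h (Ideal.mem_sup_right (S := I) (add_mem h4 h5))
  rw [mem_genDimSubgroup]
  convert h7 using 1
  simp only [smul_sub, smul_add]
  abel

/-- Modulo `𝔣²`, `e_i (x_i - 1)` is `x_i ^ e_i - 1 = ru - 1`, and `u ∈ γ₂(F)` contributes only to
`𝔣²`. -/
theorem smul_basis_sub_one_mem {e : ι → ℕ} {R : Subgroup F} {i : ι} {r u : F}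
    (hr : r ∈ R) (hu : u ∈ (⊤ : Subgroup F).lowerCentralSeries 1) (h : x i ^ e i = r * u) :
    (e i : ℤ) • (of ℤ F (x i) - 1) ∈ relIdeal R + augIdeal F ^ 2 := by
  have h1 := of_sub_one_mem_augIdeal (x i)
  have h2 : (of ℤ F (x i) - 1) * (of ℤ F (x i) - 1) ∈ augIdeal F ^ 2 := by
    rw [Submodule.pow_succ, Submodule.pow_one]
    exact Ideal.mul_mem_mul h1 h1
  have h3 := of_zpow_sub_one_sub_mem _ h2 (e i)
  rw [zpow_natCast, h] at h3
  have h4 : of ℤ F (r * u) - 1 = (of ℤ F r - 1) + of ℤ F r * (of ℤ F u - 1) := by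
    rw [map_mul]; noncomm_ring
  have h5 : of ℤ F (r * u) - 1 ∈ relIdeal R + augIdeal F ^ 2 := by
    rw [h4]
    exact add_mem (Ideal.mem_sup_left (Ideal.subset_span ⟨r, hr, rfl⟩))
      (Ideal.mem_sup_right (Ideal.mul_mem_left _ _ (of_sub_one_mem_of_mem_lowerCentralSeries hu)))
  have := sub_mem h5 (Ideal.mem_sup_right (S := relIdeal R) h3)
  rwa [sub_sub_cancel] at this

variable [LinearOrder ι]

/-- The upper bound becomes a statement on integers: `z` stands for `w - 1`, and the relation
between its coefficients and the exponents is all that remains of `w`. -/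
theorem genDimSubgroup_four_le [Fintype ι] {I : Ideal (MonoidAlgebra ℤ F)} (hI : I ≤ augIdeal F ^ 3)
    (p : ι → ι → ι → Prop)
    (hp : (⊤ : Subgroup F).lowerCentralSeries 2 ≤
      Subgroup.closure {w | ∃ j i k, p j i k ∧ w = ⁅⁅x j, x i⁆, x k⁆} ⊔
        (⊤ : Subgroup F).lowerCentralSeries 3)
    {T : Subgroup F} (hT : (⊤ : Subgroup F).lowerCentralSeries 3 ≤ T)
    (h : ∀ z ∈ I + augIdeal F ^ 4, ∀ n : ι → ι → ι → ℤ, (∀ j i k, ¬ p j i k → n j i k = 0) →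
      (∀ a b c, magnusCoeff₃ x a b c z = n a b c - n b a c - n b c a + n c b a) →
      ∀ j i k, p j i k → ⁅⁅x j, x i⁆, x k⁆ ^ n j i k ∈ T) :
    genDimSubgroup 4 I ≤ T := by
  intro w hw
  rw [mem_genDimSubgroup] at hw
  have h3 : of ℤ F w - 1 ∈ augIdeal F ^ 3 :=
    (sup_le hI (Ideal.pow_le_pow_right (by norm_num)) : I + augIdeal F ^ 4 ≤ augIdeal F ^ 3) hw
  obtain ⟨n, hn0, hn, hnT⟩ := exists_commutator_exponents x p hp
    (mem_lowerCentralSeries_two_of_sub_one_mem x h3)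
  exact hnT T hT (h _ hw n hn0 hn)

theorem lowerCentralSeries_two_le_closure_min :
    (⊤ : Subgroup F).lowerCentralSeries 2 ≤
      Subgroup.closure {w | ∃ j i k, (i < j ∧ i ≤ k) ∧ w = ⁅⁅x j, x i⁆, x k⁆} ⊔
        (⊤ : Subgroup F).lowerCentralSeries 3 :=
  lowerCentralSeries_two_le_of_min x le_sup_right fun i j k h1 h2 =>
    Subgroup.mem_sup_left (Subgroup.subset_closure ⟨j, i, k, ⟨h1, h2⟩, rfl⟩)

theorem lowerCentralSeries_two_le_closure_max :
    (⊤ : Subgroup F).lowerCentralSeries 2 ≤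
      Subgroup.closure {w | ∃ j i k, (i < j ∧ k ≤ j) ∧ w = ⁅⁅x j, x i⁆, x k⁆} ⊔
        (⊤ : Subgroup F).lowerCentralSeries 3 :=
  lowerCentralSeries_two_le_of_max x le_sup_right fun i j k h1 h2 =>
    Subgroup.mem_sup_left (Subgroup.subset_closure ⟨j, i, k, ⟨h1, h2⟩, rfl⟩)

/-- The linear coefficient is an exponent sum, so the preimage of `e_b ℤ` is a subgroup; it contains
`γ₂(F)` and every `x_i ^ e_i`. -/
theorem dvd_magnusCoeff₁_of_mem {e : ι → ℕ} {R : Subgroup F}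
    (hR : R ≤ Subgroup.closure (Set.range fun i => x i ^ e i) ⊔
    (⊤ : Subgroup F).lowerCentralSeries 1) (b : ι) {r : F} (hr : r ∈ R) :
    (e b : ℤ) ∣ magnusCoeff₁ x b (of ℤ F r - 1) := by
  let K : Subgroup F := (AddSubgroup.toSubgroup (AddSubgroup.zmultiples (e b : ℤ))).comap
    (exponentSum x b)
  have hK : ∀ g, g ∈ K ↔ (e b : ℤ) ∣ magnusCoeff₁ x b (of ℤ F g - 1) := fun g =>
    Int.mem_zmultiples_iff
  suffices h : Subgroup.closure (Set.range fun i => x i ^ e i) ⊔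
      (⊤ : Subgroup F).lowerCentralSeries 1 ≤ K from (hK r).1 (h (hR hr))
  refine sup_le ((Subgroup.closure_le K).2 ?_) fun u hu => (hK u).2 ?_
  · rintro _ ⟨i, rfl⟩
    refine (hK _).2 ?_
    rw [← toAdd_exponentSum]
    simp only [map_pow, toAdd_pow, toAdd_exponentSum, magnusCoeff₁_basis]
    split_ifs with h
    · simp [h]
    · simp
  · rw [magnusCoeff₁_eq_zero x b (of_sub_one_mem_of_mem_lowerCentralSeries hu)]
    exact dvd_zero _

end DimensionSubgroups

/-! ### Cubic monomials and coefficient divisors for the four ideals. -/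

section Sandwich

open MonoidAlgebra

variable {F : Type*} [Group F] {ι : Type*} {x : FreeGroupBasis ι F} {e : ι → ℕ} {R : Subgroup F}

theorem of_sub_one_mem_add_pow (g : F) : of ℤ F g - 1 ∈ augIdeal F + augIdeal F ^ 2 :=
  Ideal.mem_sup_left (of_sub_one_mem_augIdeal g)

theorem smul_mul_mem_augIdeal_mul_relIdeal_mul_augIdeal {a b c : ι} {d : ℤ}
    (hX : ∀ i, (e i : ℤ) • (of ℤ F (x i) - 1) ∈ relIdeal R + augIdeal F ^ 2)
    (hd : (e b : ℤ) ∣ d) :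
    d • ((of ℤ F (x a) - 1) * (of ℤ F (x b) - 1) * (of ℤ F (x c) - 1)) ∈
      augIdeal F * relIdeal R * augIdeal F + augIdeal F ^ 4 := by
  obtain ⟨t, rfl⟩ := hd
  have := zsmul_mem (mul_mem_mul_add_augIdeal_pow le_rfl (relIdeal_le_augIdeal R) le_rfl
    (of_sub_one_mem_add_pow (x a)) (hX b) (of_sub_one_mem_add_pow (x c))) t
  rwa [mul_smul_comm, smul_mul_assoc, smul_smul, mul_comm t] at this

theorem smul_mul_mem_relIdeal_mul_augIdeal_mul_relIdeal {a b c : ι} {d : ℤ}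
    (hX : ∀ i, (e i : ℤ) • (of ℤ F (x i) - 1) ∈ relIdeal R + augIdeal F ^ 2)
    (hd : (e a : ℤ) * e c ∣ d) :
    d • ((of ℤ F (x a) - 1) * (of ℤ F (x b) - 1) * (of ℤ F (x c) - 1)) ∈
      relIdeal R * augIdeal F * relIdeal R + augIdeal F ^ 4 := by
  obtain ⟨t, rfl⟩ := hd
  have := zsmul_mem (mul_mem_mul_add_augIdeal_pow (relIdeal_le_augIdeal R) le_rfl
    (relIdeal_le_augIdeal R) (hX a) (of_sub_one_mem_add_pow (x b)) (hX c)) t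
  rwa [mul_smul_comm, smul_mul_assoc, smul_mul_assoc, smul_smul, smul_smul,
    show t * e c * e a = (e a : ℤ) * e c * t by ring] at this

theorem smul_mul_mem_of_dvd_right {a b c : ι} {d : ℤ}
    (hX : ∀ i, (e i : ℤ) • (of ℤ F (x i) - 1) ∈ relIdeal R + augIdeal F ^ 2)
    (hd : (e c : ℤ) ∣ d) :
    d • ((of ℤ F (x a) - 1) * (of ℤ F (x b) - 1) * (of ℤ F (x c) - 1)) ∈
      augIdeal F ^ 2 * relIdeal R + relIdeal R * augIdeal F ^ 2 + augIdeal F ^ 4 := by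
  obtain ⟨t, rfl⟩ := hd
  have := zsmul_mem (mul_mem_mul_add_augIdeal_pow le_rfl le_rfl (relIdeal_le_augIdeal R)
    (of_sub_one_mem_add_pow (x a)) (of_sub_one_mem_add_pow (x b)) (hX c)) t
  rw [mul_smul_comm, smul_smul, mul_comm t] at this
  rw [show augIdeal F ^ 2 = augIdeal F * augIdeal F by rw [Submodule.pow_succ, Submodule.pow_one]]
  exact SetLike.le_def.1 (sup_le_sup_right le_sup_left _) this

theorem smul_mul_mem_of_dvd_left {a b c : ι} {d : ℤ}
    (hX : ∀ i, (e i : ℤ) • (of ℤ F (x i) - 1) ∈ relIdeal R + augIdeal F ^ 2)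
    (hd : (e a : ℤ) ∣ d) :
    d • ((of ℤ F (x a) - 1) * (of ℤ F (x b) - 1) * (of ℤ F (x c) - 1)) ∈
      augIdeal F ^ 2 * relIdeal R + relIdeal R * augIdeal F ^ 2 + augIdeal F ^ 4 := by
  obtain ⟨t, rfl⟩ := hd
  have := zsmul_mem (mul_mem_mul_add_augIdeal_pow (relIdeal_le_augIdeal R) le_rfl le_rfl
    (hX a) (of_sub_one_mem_add_pow (x b)) (of_sub_one_mem_add_pow (x c))) t
  rw [smul_mul_assoc, smul_mul_assoc, smul_smul, mul_comm t] at this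
  rw [show augIdeal F ^ 2 = augIdeal F * augIdeal F by rw [Submodule.pow_succ, Submodule.pow_one],
    ← mul_assoc]
  exact SetLike.le_def.1 (sup_le_sup_right le_sup_right _) this

variable [LinearOrder ι] {a b c : ι} {z : MonoidAlgebra ℤ F}

theorem dvd_magnusCoeff₃_augIdeal_mul_relIdeal_mul_augIdeal
    (hdiv : ∀ b, ∀ z ∈ relIdeal R, (e b : ℤ) ∣ magnusCoeff₁ x b z)
    (hz : z ∈ augIdeal F * relIdeal R * augIdeal F + augIdeal F ^ 4) :
    (e b : ℤ) ∣ magnusCoeff₃ x a b c z :=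
  dvd_magnusCoeff₃_of_mem_add x (fun _ hy => dvd_magnusCoeff₃_of_mem_mul x le_rfl
    (relIdeal_le_augIdeal R) le_rfl
    (fun _ _ v hv _ _ => Dvd.dvd.mul_right (Dvd.dvd.mul_left (hdiv b v hv) _) _) hy) hz

theorem dvd_magnusCoeff₃_relIdeal_mul_augIdeal_mul_relIdeal
    (hdiv : ∀ b, ∀ z ∈ relIdeal R, (e b : ℤ) ∣ magnusCoeff₁ x b z)
    (hz : z ∈ relIdeal R * augIdeal F * relIdeal R + augIdeal F ^ 4) :
    (e a : ℤ) * e c ∣ magnusCoeff₃ x a b c z :=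
  dvd_magnusCoeff₃_of_mem_add x (fun _ hy => dvd_magnusCoeff₃_of_mem_mul x (relIdeal_le_augIdeal R)
    le_rfl (relIdeal_le_augIdeal R)
    (fun u hu _ _ w hw => mul_dvd_mul (Dvd.dvd.mul_right (hdiv a u hu) _) (hdiv c w hw)) hy) hz

/-- The factor `𝔯` stands at one end or the other, so only common divisors of `e_a` and `e_c`
survive. -/
theorem dvd_magnusCoeff₃_augIdeal_sq_mul_relIdeal_add {d : ℤ}
    (hdiv : ∀ b, ∀ z ∈ relIdeal R, (e b : ℤ) ∣ magnusCoeff₁ x b z)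
    (ha : d ∣ e a) (hc : d ∣ e c)
    (hz : z ∈ augIdeal F ^ 2 * relIdeal R + relIdeal R * augIdeal F ^ 2 + augIdeal F ^ 4) :
    d ∣ magnusCoeff₃ x a b c z := by
  refine dvd_magnusCoeff₃_of_mem_add x (fun y hy => ?_) hz
  have hR := relIdeal_le_augIdeal R
  rw [show augIdeal F ^ 2 = augIdeal F * augIdeal F by rw [Submodule.pow_succ, Submodule.pow_one],
    ← mul_assoc] at hy
  obtain ⟨u, hu, v, hv, rfl⟩ := Submodule.mem_sup.1 hy
  rw [map_add]
  refine dvd_add (dvd_magnusCoeff₃_of_mem_mul x le_rfl le_rfl hR ?_ hu)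
    (dvd_magnusCoeff₃_of_mem_mul x hR le_rfl le_rfl ?_ hv)
  · exact fun _ _ _ _ w hw => Dvd.dvd.mul_left (hc.trans (hdiv c w hw)) _
  · exact fun u hu _ _ _ _ => Dvd.dvd.mul_right (Dvd.dvd.mul_right (ha.trans (hdiv a u hu)) _) _

theorem dvd_magnusCoeff₃_relIdeal_sq_mul_augIdeal_add {d : ℤ}
    (hdiv : ∀ b, ∀ z ∈ relIdeal R, (e b : ℤ) ∣ magnusCoeff₁ x b z)
    (hab : d ∣ e a * e b) (hac : d ∣ e a * e c) (hbc : d ∣ e b * e c)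
    (hz : z ∈ relIdeal R ^ 2 * augIdeal F + relIdeal R * augIdeal F * relIdeal R +
      augIdeal F * relIdeal R ^ 2 + augIdeal F ^ 4) :
    d ∣ magnusCoeff₃ x a b c z := by
  refine dvd_magnusCoeff₃_of_mem_add x (fun y hy => ?_) hz
  have hR := relIdeal_le_augIdeal R
  rw [show relIdeal R ^ 2 = relIdeal R * relIdeal R by rw [Submodule.pow_succ, Submodule.pow_one],
    ← mul_assoc (augIdeal F)] at hy
  obtain ⟨y, huv, w, hw, rfl⟩ := Submodule.mem_sup.1 hy
  obtain ⟨u, hu, v, hv, rfl⟩ := Submodule.mem_sup.1 huv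
  rw [map_add, map_add]
  refine dvd_add (dvd_add (dvd_magnusCoeff₃_of_mem_mul x hR hR le_rfl ?_ hu)
    (dvd_magnusCoeff₃_of_mem_mul x hR le_rfl hR ?_ hv))
    (dvd_magnusCoeff₃_of_mem_mul x le_rfl hR hR ?_ hw)
  · exact fun u hu v hv _ _ =>
      Dvd.dvd.mul_right (hab.trans (mul_dvd_mul (hdiv a u hu) (hdiv b v hv))) _
  · exact fun u hu _ _ w hw =>
      hac.trans (mul_dvd_mul (Dvd.dvd.mul_right (hdiv a u hu) _) (hdiv c w hw))
  · exact fun _ _ v hv w hw =>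
      hbc.trans (mul_dvd_mul (Dvd.dvd.mul_left (hdiv b v hv) _) (hdiv c w hw))

end Sandwich

/-! ### The four descriptions. -/

theorem mainTheorem5 {F : Type*} [Group F] {m : ℕ} (x : FreeGroupBasis (Fin m) F)
    (e : Fin m → ℕ) (he : ∀ i j : Fin m, i ≤ j → e j ∣ e i)
    (R : Subgroup F) [R.Normal]
    (hR : R ⊔ gammaSubgroup F 2 =
      Subgroup.closure (Set.range fun i => x i ^ e i) ⊔ gammaSubgroup F 2) :
    (genDimSubgroup 4 (augIdeal F * relIdeal R * augIdeal F) =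
      Subgroup.closure
        ({w | ∃ i j k : Fin m, i < j ∧ w = ⁅⁅x j, x i⁆, x k⁆ ^ e i} ∪
         {w | ∃ (i j : Fin m) (n : ℤ), i < j ∧ (e j : ℤ) ∣ n ∧ (e i : ℤ) ∣ 2 * n ∧
            w = ⁅⁅x j, x i⁆, x j⁆ ^ n}) ⊔ gammaSubgroup F 4) ∧
    (genDimSubgroup 4 (relIdeal R * augIdeal F * relIdeal R) =
      Subgroup.closure
        ({w | ∃ i j k : Fin m, i < j ∧ w = ⁅⁅x j, x i⁆, x k⁆ ^ (e i * e k)} ∪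
         {w | ∃ (i j : Fin m) (n : ℤ), i < j ∧ (e j * e i : ℤ) ∣ n ∧ (e i : ℤ) ^ 2 ∣ 2 * n ∧
            w = ⁅⁅x j, x i⁆, x i⁆ ^ n}) ⊔ gammaSubgroup F 4) ∧
    (genDimSubgroup 4 (relIdeal R ^ 2 * augIdeal F + relIdeal R * augIdeal F * relIdeal R +
        augIdeal F * relIdeal R ^ 2) =
      ⁅⁅(⊤ : Subgroup F), R⁆, R⁆ ⊔ gammaSubgroup F 4) ∧
    (genDimSubgroup 4 (augIdeal F ^ 2 * relIdeal R + relIdeal R * augIdeal F ^ 2) =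
      Subgroup.closure
        {w | ∃ (i j k : Fin m) (n : ℤ), i < j ∧ i ≤ k ∧ (k ≠ i → (e k : ℤ) ∣ n) ∧
            (k = i → (e j : ℤ) ∣ n ∧ (e i : ℤ) ∣ 2 * n) ∧
            w = ⁅⁅x j, x i⁆, x k⁆ ^ n} ⊔ gammaSubgroup F 4) := by
  have he' : ∀ i j : Fin m, i ≤ j → (e j : ℤ) ∣ e i := fun i j h =>
    Int.natCast_dvd_natCast.2 (he i j h)
  have hdiv : ∀ b, ∀ z ∈ relIdeal R, (e b : ℤ) ∣ magnusCoeff₁ x b z := fun b z hz =>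
    dvd_magnusCoeff₁_of_mem_relIdeal x
      (fun r hr => dvd_magnusCoeff₁_of_mem x (hR ▸ le_sup_left) b hr) hz
  have hmul : ∀ i, ∃ r ∈ R, ∃ u ∈ (⊤ : Subgroup F).lowerCentralSeries 1, x i ^ e i = r * u := by
    intro i
    have hi : x i ^ e i ∈ R ⊔ gammaSubgroup F 2 :=
      hR ▸ Subgroup.mem_sup_left (Subgroup.subset_closure ⟨i, rfl⟩)
    obtain ⟨r, hr, u, hu, h⟩ := Subgroup.mem_sup_of_normal_right.1 hi
    exact ⟨r, hr, u, hu, h.symm⟩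
  have hX : ∀ i, (e i : ℤ) • (MonoidAlgebra.of ℤ F (x i) - 1) ∈ relIdeal R + augIdeal F ^ 2 := by
    intro i
    obtain ⟨r, hr, u, hu, h⟩ := hmul i
    exact smul_basis_sub_one_mem x hr hu h
  have hf := le_refl (augIdeal F)
  have hr := relIdeal_le_augIdeal R
  have hf2 : augIdeal F ^ 2 = augIdeal F * augIdeal F := by
    rw [Submodule.pow_succ, Submodule.pow_one]
  have hr2 : relIdeal R ^ 2 = relIdeal R * relIdeal R := by
    rw [Submodule.pow_succ, Submodule.pow_one]
  refine ⟨le_antisymm ?_ (sup_le ((Subgroup.closure_le _).2 ?_)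
      (lowerCentralSeries_three_le_genDimSubgroup _)),
    le_antisymm ?_ (sup_le ((Subgroup.closure_le _).2 ?_)
      (lowerCentralSeries_three_le_genDimSubgroup _)),
    le_antisymm ?_ (sup_le (commutator_le_genDimSubgroup R)
      (lowerCentralSeries_three_le_genDimSubgroup _)),
    le_antisymm ?_ (sup_le ((Subgroup.closure_le _).2 ?_)
      (lowerCentralSeries_three_le_genDimSubgroup _))⟩
  -- Largest letter first: for `k ≠ j` the monomial `X_k X_i X_j`, with middle letter `x_i`, then
  -- isolates the exponent and gives the divisor `e_i`.
  · refine genDimSubgroup_four_le x (mul_le_augIdeal_pow_three hf hr hf) _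
      (lowerCentralSeries_two_le_closure_max x) le_sup_right ?_
    rintro z hz n hn0 hn j i k ⟨hij, hkj⟩
    have hd := fun a b c =>
      dvd_magnusCoeff₃_augIdeal_mul_relIdeal_mul_augIdeal (a := a) (b := b) (c := c) hdiv hz
    simp only [hn] at hd
    rcases eq_or_ne k j with rfl | hk
    -- With `k = j`, the monomial `X_j X_i X_j` has coefficient `2n` and `X_i X_j X_j` has `-n`,
    -- their middle letters giving `e_i` and `e_j`.
    · have h1 := hd k i k
      have h2 := hd i k k
      rw [hn0 i k k (by omega), hn0 k k i (by omega)] at h2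
      rw [hn0 i k k (by omega)] at h1
      refine Subgroup.mem_sup_left (Subgroup.subset_closure (Or.inr ⟨i, k, _, hij, ?_, ?_, rfl⟩))
      · simpa using h2
      · simpa [two_mul] using h1
    · have h1 := hd k i j
      rw [hn0 k i j (by omega), hn0 i k j (by omega), hn0 i j k (by omega)] at h1
      obtain ⟨t, ht⟩ : (e i : ℤ) ∣ n j i k := by simpa using h1
      rw [ht, zpow_mul, zpow_natCast]
      refine zpow_mem ?_ t
      exact Subgroup.mem_sup_left (Subgroup.subset_closure (Or.inl ⟨i, j, k, hij, rfl⟩))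
  · rintro _ (⟨i, j, k, hij, rfl⟩ | ⟨i, j, n, hij, h1, h2, rfl⟩)
    · have hij' := he' i j hij.le
      rw [← zpow_natCast]
      refine zpow_commutator_mem_genDimSubgroup x (add_mem (sub_mem (sub_mem ?_ ?_) ?_) ?_)
      all_goals
        refine smul_mul_mem_augIdeal_mul_relIdeal_mul_augIdeal hX ?_
        first | exact dvd_rfl | exact hij'
    · have h3 := smul_mul_mem_augIdeal_mul_relIdeal_mul_augIdeal (a := j) (c := j) hX h2
      refine zpow_commutator_mem_genDimSubgroup x ?_
      rw [two_mul, add_smul] at h3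
      have h4 := smul_mul_mem_augIdeal_mul_relIdeal_mul_augIdeal (a := i) (c := j) hX h1
      have h5 := smul_mul_mem_augIdeal_mul_relIdeal_mul_augIdeal (a := j) (c := i) hX h1
      convert sub_mem (sub_mem h3 h4) h5 using 1
      abel
  · refine genDimSubgroup_four_le x (mul_le_augIdeal_pow_three hr hf hr) _
      (lowerCentralSeries_two_le_closure_min x) le_sup_right ?_
    rintro z hz n hn0 hn j i k ⟨hij, hik⟩
    have hd := fun a b c =>
      dvd_magnusCoeff₃_relIdeal_mul_augIdeal_mul_relIdeal (a := a) (b := b) (c := c) hdiv hz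
    simp only [hn] at hd
    rcases eq_or_ne k i with rfl | hk
    -- With `k = i`, the coefficient at `X_j X_i X_i` is `n`, and at `X_i X_j X_i` it is `-2n`; the
    -- outer letters give `e_j e_i` and `e_i²`.
    · have h1 := hd j k k
      have h2 := hd k j k
      rw [hn0 k j k (by omega)] at h1 h2
      refine Subgroup.mem_sup_left (Subgroup.subset_closure (Or.inr ⟨k, j, _, hij, ?_, ?_, rfl⟩))
      · simpa using h1
      · have h3 := Int.dvd_neg.2 h2
        rw [pow_two]
        convert h3 using 1
        ring
    · have h1 := hd i j k
      rw [hn0 i j k (by omega), hn0 j k i (by omega), hn0 k j i (by omega)] at h1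
      obtain ⟨t, ht⟩ : (e i : ℤ) * e k ∣ n j i k := by simpa using h1
      rw [ht, zpow_mul, ← Nat.cast_mul, zpow_natCast]
      refine zpow_mem ?_ t
      exact Subgroup.mem_sup_left (Subgroup.subset_closure (Or.inl ⟨i, j, k, hij, rfl⟩))
  · rintro _ (⟨i, j, k, hij, rfl⟩ | ⟨i, j, n, hij, h1, h2, rfl⟩)
    · have hij' := he' i j hij.le
      rw [← zpow_natCast, Nat.cast_mul]
      refine zpow_commutator_mem_genDimSubgroup x (add_mem (sub_mem (sub_mem ?_ ?_) ?_) ?_)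
      all_goals
        refine smul_mul_mem_relIdeal_mul_augIdeal_mul_relIdeal hX ?_
        first
          | exact dvd_rfl
          | exact mul_dvd_mul_right hij' _
          | exact (mul_comm _ _).dvd
          | exact (mul_comm _ _).dvd.trans (mul_dvd_mul_right hij' _)
    -- The leading form is `X_j X_i X_i - 2 X_i X_j X_i + X_i X_i X_j`, so only the middle monomial
    -- uses the hypothesis on `2n`.
    · rw [pow_two] at h2
      have h3 := smul_mul_mem_relIdeal_mul_augIdeal_mul_relIdeal (b := j) hX h2
      refine zpow_commutator_mem_genDimSubgroup x ?_
      rw [two_mul, add_smul] at h3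
      have h4 := smul_mul_mem_relIdeal_mul_augIdeal_mul_relIdeal (b := i) hX h1
      rw [mul_comm] at h1
      have h5 := smul_mul_mem_relIdeal_mul_augIdeal_mul_relIdeal (b := i) hX h1
      convert sub_mem (add_mem h4 h5) h3 using 1
      abel
  · have hle : relIdeal R ^ 2 * augIdeal F + relIdeal R * augIdeal F * relIdeal R +
        augIdeal F * relIdeal R ^ 2 ≤ augIdeal F ^ 3 := by
      rw [hr2, ← mul_assoc (augIdeal F)]
      exact sup_le (sup_le (mul_le_augIdeal_pow_three hr hr hf)
        (mul_le_augIdeal_pow_three hr hf hr)) (mul_le_augIdeal_pow_three hf hr hr)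
    refine genDimSubgroup_four_le x hle _
      (lowerCentralSeries_two_le_closure_min x) le_sup_right ?_
    rintro z hz n hn0 hn j i k ⟨hij, hik⟩
    have hij' := he' i j hij.le
    have hik' := he' i k hik
    -- Since `e_j` and `e_k` divide `e_i`, the product `e_j e_k` divides all three pairwise products
    -- for the chosen monomial, `X_j X_i X_i` or `X_i X_j X_k`.
    have hdvd : (e j : ℤ) * e k ∣ n j i k := by
      rcases eq_or_ne k i with rfl | hk
      · have h1 := dvd_magnusCoeff₃_relIdeal_sq_mul_augIdeal_add (a := j) (b := k) (c := k)
          (d := e j * e k) hdiv dvd_rfl dvd_rfl (mul_dvd_mul_right hij' _) hz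
        rw [hn, hn0 k j k (by omega)] at h1
        simpa using h1
      · have h1 := dvd_magnusCoeff₃_relIdeal_sq_mul_augIdeal_add (a := i) (b := j) (c := k)
          (d := e j * e k) hdiv ((mul_comm _ _).dvd.trans (mul_dvd_mul_right hik' _))
          (mul_dvd_mul_right hij' _) dvd_rfl hz
        rw [hn, hn0 i j k (by omega), hn0 j k i (by omega), hn0 k j i (by omega)] at h1
        simpa using h1
    obtain ⟨t, ht⟩ := hdvd
    rw [ht, zpow_mul]
    refine zpow_mem ?_ t
    obtain ⟨r, hr, u, hu, h⟩ := hmul j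
    obtain ⟨s, hs, v, hv, h'⟩ := hmul k
    -- The swap puts `x_j` in the middle, so that `[[x_i,x_j],x_k]` to the power `e_j e_k` agrees
    -- modulo `γ₄(F)` with `[[x_i,r],s]`, an element of `[[F,R],R]`.
    refine zpow_commutator_mem_of_swap le_sup_right (zpow_commutator_mem le_sup_right hu hv
      ((zpow_natCast _ _).trans h) ((zpow_natCast _ _).trans h') (Subgroup.mem_sup_left ?_))
    exact Subgroup.commutator_mem_commutator
      (Subgroup.commutator_mem_commutator (Subgroup.mem_top _) hr) hs
  · have hle : augIdeal F ^ 2 * relIdeal R + relIdeal R * augIdeal F ^ 2 ≤ augIdeal F ^ 3 := by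
      rw [hf2, ← mul_assoc]
      exact sup_le (mul_le_augIdeal_pow_three hf hf hr) (mul_le_augIdeal_pow_three hr hf hf)
    refine genDimSubgroup_four_le x hle _
      (lowerCentralSeries_two_le_closure_min x) le_sup_right ?_
    rintro z hz n hn0 hn j i k ⟨hij, hik⟩
    refine Subgroup.mem_sup_left (Subgroup.subset_closure ⟨i, j, k, _, hij, hik, ?_, ?_, rfl⟩)
    · intro hk
      have h1 := dvd_magnusCoeff₃_augIdeal_sq_mul_relIdeal_add (a := i) (b := j) (c := k)
        hdiv (he' i k hik) dvd_rfl hz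
      rw [hn, hn0 i j k (by omega), hn0 j k i (by omega), hn0 k j i (by omega)] at h1
      simpa using h1
    · rintro rfl
      -- The monomial `X_j X_i X_i` has end letters `x_j, x_i` and yields `e_j ∣ n`; `X_i X_j X_i`
      -- has both ends `x_i` and yields `e_i ∣ 2n`.
      have h1 := dvd_magnusCoeff₃_augIdeal_sq_mul_relIdeal_add (a := j) (b := k) (c := k)
        hdiv dvd_rfl (he' k j hij.le) hz
      have h2 := dvd_magnusCoeff₃_augIdeal_sq_mul_relIdeal_add (a := k) (b := j) (c := k)
        hdiv dvd_rfl dvd_rfl hz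
      rw [hn, hn0 k j k (by omega)] at h1 h2
      refine ⟨by simpa using h1, ?_⟩
      convert Int.dvd_neg.2 h2 using 1
      ring
  · rintro _ ⟨i, j, k, n, hij, hik, h1, h2, rfl⟩
    refine zpow_commutator_mem_genDimSubgroup x ?_
    rcases eq_or_ne k i with rfl | hk
    · obtain ⟨h3, h4⟩ := h2 rfl
      have h5 := smul_mul_mem_of_dvd_left (b := j) (c := k) hX h4
      rw [two_mul, add_smul] at h5
      have h6 := smul_mul_mem_of_dvd_left (b := k) (c := k) hX h3
      have h7 := smul_mul_mem_of_dvd_right (a := k) (b := k) hX h3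
      convert sub_mem (add_mem h6 h7) h5 using 1
      abel
    · have h3 := h1 hk
      refine add_mem (sub_mem (sub_mem ?_ ?_) ?_) ?_
      · exact smul_mul_mem_of_dvd_right hX h3
      · exact smul_mul_mem_of_dvd_right hX h3
      · exact smul_mul_mem_of_dvd_left hX h3
      · exact smul_mul_mem_of_dvd_left hX h3
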